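/- Let $M$ be a smooth manifold (Hausdorff, second countable, without boundary), let $\mathcal F$ be a regular foliation of $M$ with tangent bundle $T\mathcal F\subseteq TM$, and let $\gamma\colon TM\to TM$ be (the projection of) an Ehresmann connection complementary to $T\mathcal F$: a smooth bundle endomorphism with $\gamma^2=\gamma$ and $\operatorname{Im}\gamma=T\mathcal F$. Put $\mathbb H=\ker\gamma$, so that $TM=\mathbb H\oplus T\mathcal F$. For a Lie algebroid $(E,q,[\![\cdot,\cdot]\!])$ over $M$, the associated operator $D\colon\Gamma(\Lambda^pE^*)\to\Gamma(\Lambda^{p+1}E^*)$ is the derivation of degree $1$ with $Df(A)=qA(f)$ and $D\alpha(A,B)=qA(\alpha(B))-qB(\alpha(A))-\alpha([\![A,B]\!])$ for functions $f$, $1$-forms $\alpha$ and sections $A,B$ of $E$; it is given by the Koszul formula $$D\theta(A_0,\dots,A_p)=\sum_i(-1)^i\,qA_i\bigl(\theta(\dots,\widehat{A_i},\dots)\bigr)+\sum_{i<j}(-1)^{i+j}\theta([\![A_i,A_j]\!],\dots,\widehat{A_i},\dots,\widehat{A_j},\dots).$$ For $(TM,\mathrm{Id},[\cdot,\cdot])$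 it is the exterior differential $\mathrm d$. The Lie algebroid of $\mathcal F$ is $T\mathcal F$ with the restriction of the Lie bracket and the inclusion as anchor; its associated operator is the foliated differential $\mathrm d_{\mathcal F}$. The connection $\gamma$ defines a Lie algebroid on $TM$ with anchor $\gamma$ and bracket $$[\![X,Y]\!]=[X,Y]_\gamma+T_\gamma(X,Y),$$ where $[X,Y]_\gamma=[\gamma X,Y]+[X,\gamma Y]-\gamma[X,Y]$ and $T_\gamma(X,Y)=[\gamma X,\gamma Y]-\gamma[\gamma X,Y]-\gamma[X,\gamma Y]+\gamma^2[X,Y]$; let $D$ be its associated operator. A form is of type $(a,b)$ if it has degree $a+b$ and vanishes whenever more than $b$ of its arguments are in $\Gamma(T\mathcal F)$ or more than $a$ are in $\Gamma(\mathbb H)$. With respect to this bigrading $\mathrm d=\mathrm d_{1,0}+\mathrm d_{2,-1}+\mathrm d_{0,1}$, where $\mathrm d_{i,j}$ maps forms of type $(a,b)$ to forms of type $(a+i,b+j)$. Theorem. The operators $D$ and $\mathrm d_{\mathcal F}$ are cohomology operators ($D^2=0$, $\mathrm d_{\mathcal F}^2=0$), and: 1. $D=\mathrm d_{0,1}$.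 2. $\Gamma(T\mathcal F)$ is closed under $[\![\cdot,\cdot]\!]$, and the restriction to $T\mathcal F$ of the Lie algebroid $(TM,\gamma,[\![\cdot,\cdot]\!])$ is the Lie algebroid of $\mathcal F$. 3. Let $\mathbb H^0\subseteq T^*M$ be the annihilator of $\mathbb H$, so that $\Gamma(\Lambda\mathbb H^0)$ consists of the forms which vanish as soon as one argument lies in $\mathbb H$. Then $\mathrm d_{0,1}$ maps $\Gamma(\Lambda^p\mathbb H^0)$ to $\Gamma(\Lambda^{p+1}\mathbb H^0)$, and the complexes $(\Gamma(\Lambda T^*\mathcal F),\mathrm d_{\mathcal F})$ and $(\Gamma(\Lambda\mathbb H^0),\mathrm d_{0,1})$ are isomorphic, through the $C^\infty(M)$-linear isomorphisms $h$ with $(h\alpha)(X_1,\dots,X_p)=\alpha(\gamma X_1,\dots,\gamma X_p)$. -/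

import Mathlib

open scoped Manifold ContDiff

noncomputable section

namespace FoliatedAlgebroid

section Manifold

variable {n : ℕ} {M : Type*} [TopologicalSpace M] [ChartedSpace (EuclideanSpace ℝ (Fin n)) M]

/-- The ring `C^∞(M)`. -/
abbrev Fun (n : ℕ) (M : Type*) [TopologicalSpace M]
    [ChartedSpace (EuclideanSpace ℝ (Fin n)) M] := C^∞⟮𝓡 n, M; 𝓘(ℝ, ℝ), ℝ⟯

/-- The smooth vector fields on `M`, i.e. the smooth sections of the tangent bundle. -/
abbrev VF (n : ℕ) (M : Type*) [TopologicalSpace M]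
    [ChartedSpace (EuclideanSpace ℝ (Fin n)) M] [IsManifold (𝓡 n) ∞ M] :=
  Cₛ^∞⟮𝓡 n; EuclideanSpace ℝ (Fin n), (TangentSpace (𝓡 n) : M → Type _)⟯

variable [IsManifold (𝓡 n) ∞ M]

instance VF.instSMulFun : SMul (Fun n M) (VF n M) :=
  ⟨fun f X => ⟨fun x => f x • X x, f.contMDiff.smul_section X.contMDiff⟩⟩

@[simp] theorem VF.fun_smul_apply (f : Fun n M) (X : VF n M) (x : M) :
    (f • X) x = f x • X x := rfl

instance VF.instModuleFun : Module (Fun n M) (VF n M) where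
  one_smul X := by ext1 x; simp
  mul_smul f g X := by ext1 x; simp [mul_smul]
  smul_zero f := by ext1 x; simp
  zero_smul X := by ext1 x; simp
  smul_add f X Y := by ext1 x; simp
  add_smul f g X := by ext1 x; simp [add_smul]

instance VF.instTower : IsScalarTower ℝ (Fun n M) (VF n M) where
  smul_assoc c f X := by ext1 x; simp [mul_smul]

theorem VF.mdiff (X : VF n M) (x : M) :
    MDifferentiableAt (𝓡 n) ((𝓡 n).prod 𝓘(ℝ, EuclideanSpace ℝ (Fin n)))
      (fun x => (X x : TangentBundle (𝓡 n) M)) x :=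
  (X.contMDiff x).mdifferentiableAt (by simp)

theorem Fun.mdiff (f : Fun n M) (x : M) : MDifferentiableAt (𝓡 n) 𝓘(ℝ, ℝ) f x :=
  (f.contMDiff x).mdifferentiableAt (by simp)

/-- A vector field `X` as the derivation `f ↦ X f = df(X)` of `C^∞(M)`. -/
def dirDeriv : VF n M →ₗ[Fun n M] Derivation ℝ (Fun n M) (Fun n M) where
  toFun X := Derivation.mk'
    { toFun := fun f => ⟨fun x => mvfderiv (𝓡 n) f x (X x), by
        have h1 := (f.contMDiff.contMDiff_tangentMap (m := ∞) (by simp)).comp X.contMDiff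
        intro x
        have h2 := h1 x
        rw [Bundle.contMDiffAt_totalSpace] at h2
        simpa using! h2.2⟩
      map_add' := fun f g => by
        ext x
        simpa using! congrArg (fun L => L (X x)) (mvfderiv_add (f.mdiff x) (g.mdiff x))
      map_smul' := fun c f => by
        ext x
        have := mvfderiv_smul (I := 𝓡 n) (x := x) (mdifferentiableAt_const (c := c)) (f.mdiff x)
        have := congrArg (fun L => L (X x)) this
        simpa [mvfderiv_const] using! this }
    (fun f g => by
      ext x
      have := congrArg (fun L => L (X x)) (mvfderiv_mul (f.mdiff x) (g.mdiff x))
      simpa using! this)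
  map_add' X Y := by ext f x; exact map_add (mvfderiv (𝓡 n) f x) (X x) (Y x)
  map_smul' f X := by ext g x; exact map_smul (mvfderiv (𝓡 n) g x) (f x) (X x)

@[simp] theorem dirDeriv_apply (X : VF n M) (f : Fun n M) (x : M) :
    dirDeriv X f x = mvfderiv (𝓡 n) f x (X x) := rfl

/-- The Lie bracket `[X, Y]` of vector fields. -/
def lieBr : VF n M →ₗ[ℝ] VF n M →ₗ[ℝ] VF n M :=
  LinearMap.mk₂ ℝ (fun X Y => ⟨fun x => VectorField.mlieBracket (𝓡 n) X Y x, by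
      have : IsManifold (𝓡 n) (minSmoothness ℝ 2) M :=
        IsManifold.of_le (n := ∞) (by simp; exact ENat.LEInfty.out)
      have : IsManifold (𝓡 n) (((⊤ : ℕ∞) : WithTop ℕ∞) + 1) M := by simpa
      exact ContDiff.mlieBracket_vectorField (n := ⊤) X.contMDiff Y.contMDiff (by simp)⟩)
    (fun X X' Y => by ext1 x; exact VectorField.mlieBracket_add_left (X.mdiff x) (X'.mdiff x))
    (fun c X Y => by ext1 x; exact VectorField.mlieBracket_const_smul_left (X.mdiff x))
    (fun X Y Y' => by ext1 x; exact VectorField.mlieBracket_add_right (Y.mdiff x) (Y'.mdiff x))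
    (fun c X Y => by ext1 x; exact VectorField.mlieBracket_const_smul_right (Y.mdiff x))

theorem lieBr_apply (X Y : VF n M) (x : M) :
    lieBr X Y x = VectorField.mlieBracket (𝓡 n) X Y x := rfl

theorem lieBr_self (X : VF n M) : lieBr X X = 0 := by
  ext1 x; simp [lieBr_apply]

theorem lieBr_jacobi (X Y Z : VF n M) :
    lieBr X (lieBr Y Z) = lieBr (lieBr X Y) Z + lieBr Y (lieBr X Z) := by
  have : IsManifold (𝓡 n) (minSmoothness ℝ 3) M := IsManifold.of_le (n := ∞) (by simp; exact ENat.LEInfty.out)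
  ext1 x
  exact VectorField.leibniz_identity_mlieBracket_apply ((X.contMDiff x).of_le (by simp; exact ENat.LEInfty.out))
    ((Y.contMDiff x).of_le (by simp; exact ENat.LEInfty.out)) ((Z.contMDiff x).of_le (by simp; exact ENat.LEInfty.out))

theorem lieBr_leibniz (X Y : VF n M) (f : Fun n M) :
    lieBr X (f • Y) = f • lieBr X Y + dirDeriv X f • Y := by
  ext1 x
  rw [add_comm]
  exact VectorField.mlieBracket_smul_right (f.mdiff x) (Y.mdiff x)

end Manifold

section Koszul
variable {A L : Type*} [CommRing A] [Algebra ℝ A] [AddCommGroup L] [Module A L] [Module ℝ L]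
  [IsScalarTower ℝ A L]

/-- The value of the Koszul formula on the vectors `v 0, …, v p`:
`∑ i, (-1)^i ρ(v i) (θ(…, v̂ i, …)) + ∑ i < j, (-1)^(i+j) θ([v i, v j], …, v̂ i, …, v̂ j, …)`.
In the second sum a pair of positions `a < b` is encoded as `a = i`, `b = j + 1` with `i ≤ j`,
which accounts for its minus sign. -/
def koszulFun (ρ : L → Derivation ℝ A A) (br : L → L → L) :
    (p : ℕ) → (L [⋀^Fin p]→ₗ[A] A) → (Fin (p + 1) → L) → A
  | 0, θ, v => ρ (v 0) (θ ![])
  | p + 1, θ, v =>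
      (∑ i : Fin (p + 2), (-1 : ℤ) ^ (i : ℕ) • ρ (v i) (θ (i.removeNth v))) -
        ∑ i : Fin (p + 1), ∑ j ≥ i, (-1 : ℤ) ^ (i + j : ℕ) •
          θ (Matrix.vecCons (br (v i.castSucc) (v j.succ))
            (j.removeNth (i.castSucc.removeNth v)))

variable (ρ : L →ₗ[A] Derivation ℝ A A) (br : L →ₗ[ℝ] L →ₗ[ℝ] L)

/-- An alternating map over `A` regarded as an alternating map over `ℝ`. -/
def toReal {p : ℕ} : (L [⋀^Fin p]→ₗ[A] A) →ₗ[ℝ] (L [⋀^Fin p]→ₗ[ℝ] A) where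
  toFun θ := { θ.toMultilinearMap.restrictScalars ℝ with
    map_eq_zero_of_eq' := θ.map_eq_zero_of_eq' }
  map_add' _ _ := rfl
  map_smul' _ _ := rfl

@[simp] theorem toReal_apply {p : ℕ} (θ : L [⋀^Fin p]→ₗ[A] A) (v : Fin p → L) :
    toReal θ v = θ v := rfl

/-- First half of the Koszul formula. -/
def koszulOne {p : ℕ} (θ : L [⋀^Fin p]→ₗ[A] A) : L [⋀^Fin (p + 1)]→ₗ[ℝ] A :=
  AlternatingMap.alternatizeUncurryFin
    { toFun := fun X => (ρ X : A →ₗ[ℝ] A).compAlternatingMap (toReal θ)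
      map_add' := fun X Y => by ext v; simp
      map_smul' := fun c X => by
        ext v
        simp only [LinearMap.compAlternatingMap_apply, Derivation.coeFn_coe, RingHom.id_apply,
          AlternatingMap.smul_apply]
        rw [← algebraMap_smul A c X, map_smul, Derivation.smul_apply, algebraMap_smul] }

/-- Second half of the Koszul formula. -/
def koszulTwo {p : ℕ} (θ : L [⋀^Fin (p + 1)]→ₗ[A] A) : L [⋀^Fin (p + 2)]→ₗ[ℝ] A :=
  AlternatingMap.alternatizeUncurryFin
    (AlternatingMap.alternatizeUncurryFinLM ∘ₗ
      (br.compr₂ (AlternatingMap.curryLeft (toReal θ))))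

theorem koszulTwo_apply (hbr : ∀ X, br X X = 0) {p : ℕ} (θ : L [⋀^Fin (p + 1)]→ₗ[A] A)
    (v : Fin (p + 2) → L) :
    (1 / 2 : ℝ) • koszulTwo br θ v = ∑ i : Fin (p + 1), ∑ j ≥ i, (-1 : ℤ) ^ (i + j : ℕ) •
          θ (Matrix.vecCons (br (v i.castSucc) (v j.succ))
            (j.removeNth (i.castSucc.removeNth v))) := by
  have hanti : ∀ X Y, br Y X = - br X Y := fun X Y => by
    have := hbr (X + Y)
    simp only [map_add, LinearMap.add_apply, hbr] at this
    rw [zero_add, add_zero] at this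
    exact eq_neg_of_add_eq_zero_left this
  rw [koszulTwo, AlternatingMap.alternatizeUncurryFin_alternatizeUncurryFinLM_comp_apply,
    Finset.smul_sum]
  refine Finset.sum_congr rfl fun i _ => ?_
  rw [Finset.smul_sum]
  refine Finset.sum_congr rfl fun j _ => ?_
  rw [smul_comm]
  congr 1
  simp only [LinearMap.compr₂_apply, hanti (v i.castSucc) (v j.succ), map_neg,
    AlternatingMap.neg_apply, AlternatingMap.curryLeft_apply_apply, toReal_apply]
  rw [sub_neg_eq_add, ← two_smul ℝ, smul_smul]
  norm_num

/-- The Koszul formula as a real alternating map. -/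
def koszulReal : {p : ℕ} → (L [⋀^Fin p]→ₗ[A] A) → L [⋀^Fin (p + 1)]→ₗ[ℝ] A
  | 0, θ => koszulOne ρ θ
  | _ + 1, θ => koszulOne ρ θ - (1 / 2 : ℝ) • koszulTwo br θ

theorem koszulReal_apply (hbr : ∀ X, br X X = 0) {p : ℕ} (θ : L [⋀^Fin p]→ₗ[A] A)
    (v : Fin (p + 1) → L) :
    koszulReal ρ br θ v = koszulFun ρ (fun X Y => br X Y) p θ v := by
  cases p with
  | zero =>
    simp only [koszulReal, koszulFun, koszulOne, AlternatingMap.alternatizeUncurryFin_apply]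
    simp
    congr 2
    exact Subsingleton.elim _ _
  | succ p =>
    simp only [koszulReal, koszulFun, AlternatingMap.sub_apply, AlternatingMap.smul_apply,
      koszulTwo_apply br hbr]
    congr 1
    simp [koszulOne, AlternatingMap.alternatizeUncurryFin_apply]

theorem removeNth_update_zero {m : ℕ} (k : Fin (m + 2)) (hk : k ≠ 0) (w : Fin (m + 2) → L)
    (y : L) : k.removeNth (Function.update w 0 y) = Function.update (k.removeNth w) 0 y := by
  funext l
  simp only [Fin.removeNth_apply, Function.update_apply, Fin.succAbove_eq_zero_iff hk]

theorem vecCons_smul_eq_update {m : ℕ} (f : A) (X : L) (v : Fin m → L) :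
    Matrix.vecCons (f • X) v = Function.update (Matrix.vecCons X v) 0 (f • X) := by
  funext l
  cases l using Fin.cases <;> simp

theorem koszulFun_cons_smul (hbr : ∀ X, br X X = 0)
    (hleib : ∀ (X Y : L) (f : A), br X (f • Y) = f • br X Y + ρ X f • Y)
    {p : ℕ} (θ : L [⋀^Fin p]→ₗ[A] A) (f : A) (X : L) (v : Fin p → L) :
    koszulFun ρ (fun X Y => br X Y) p θ (Matrix.vecCons (f • X) v) =
      f * koszulFun ρ (fun X Y => br X Y) p θ (Matrix.vecCons X v) := by
  have hanti : ∀ X Y, br Y X = - br X Y := fun X Y => by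
    have := hbr (X + Y)
    simp only [map_add, LinearMap.add_apply, hbr] at this
    rw [zero_add, add_zero] at this
    exact eq_neg_of_add_eq_zero_left this
  have hleft : ∀ X Y (f : A), br (f • X) Y = f • br X Y - ρ Y f • X := fun X Y f => by
    rw [hanti Y, hleib, hanti X Y]; simp; abel
  cases p with
  | zero => simp [koszulFun]
  | succ p =>
    have h1 : ∀ i : Fin (p + 1), (ρ (v i)) (θ (i.succ.removeNth (Matrix.vecCons (f • X) v))) =
        f * ρ (v i) (θ (i.succ.removeNth (Matrix.vecCons X v))) +
          θ (Matrix.vecCons X (i.removeNth v)) * ρ (v i) f := by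
      intro i
      have e1 : ∀ Y : L, i.succ.removeNth (Matrix.vecCons Y v) =
          Matrix.vecCons Y (i.removeNth v) := by
        intro Y; funext l
        cases l using Fin.cases <;> simp [Fin.removeNth_apply]
      rw [e1, e1, vecCons_smul_eq_update, θ.map_update_smul, smul_eq_mul, Derivation.leibniz,
        Function.update_eq_self_iff.2 (by simp)]
      simp [smul_eq_mul]
    have h2 : ∀ j : Fin (p + 1), θ (Matrix.vecCons (br (f • X) (v j)) (j.removeNth v)) =
        f * θ (Matrix.vecCons (br X (v j)) (j.removeNth v)) -
          θ (Matrix.vecCons X (j.removeNth v)) * ρ (v j) f := by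
      intro j
      have e := (AlternatingMap.curryLeft θ).map_sub (f • br X (v j)) (ρ (v j) f • X)
      have e' := congrArg (fun T => T (j.removeNth v)) e
      simp only [AlternatingMap.sub_apply, map_smul, AlternatingMap.smul_apply,
        AlternatingMap.curryLeft_apply_apply, smul_eq_mul] at e'
      rw [hleft, e']; ring
    have h3 : ∀ (i : Fin p) (j : Fin (p + 1)), i.succ ≤ j → ∀ a : L,
        θ (Matrix.vecCons a (j.removeNth (i.succ.castSucc.removeNth
          (Matrix.vecCons (f • X) v)))) =
        f * θ (Matrix.vecCons a (j.removeNth (i.succ.castSucc.removeNth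
          (Matrix.vecCons X v)))) := by
      intro i j hij a
      obtain _ | p := p
      · exact i.elim0
      have hj : j ≠ 0 := by
        rintro rfl
        simp at hij
      have hi : i.succ.castSucc ≠ 0 := by simp
      rw [vecCons_smul_eq_update, removeNth_update_zero _ hi, removeNth_update_zero _ hj]
      have e2 : ∀ (u : Fin (p + 1) → L) (y : L), Matrix.vecCons a (Function.update u 0 y) =
          Function.update (Matrix.vecCons a u) 1 y := by
        intro u y; funext l
        cases l using Fin.cases with
        | zero => simp
        | succ l =>
          cases l using Fin.cases with
          | zero => simp
          | succ l => 
            rw [Matrix.cons_val_succ, Function.update_of_ne (by simp),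
              Function.update_of_ne (by exact Fin.succ_succ_ne_one l),
              Matrix.cons_val_succ]
      rw [e2, θ.map_update_smul, smul_eq_mul, Function.update_eq_self_iff.2]
      simp only [Matrix.cons_val_one, Fin.removeNth_apply]
      rw [Fin.succAbove_ne_zero_zero hj, Fin.succAbove_ne_zero_zero hi]
      simp
    have h0 : ∀ Y : L, (0 : Fin (p + 2)).removeNth (Matrix.vecCons Y v) = v := by
      intro Y; funext l; simp [Fin.removeNth_apply]
    have hh : ∀ (Y : L) (i : Fin p), Matrix.vecCons Y v i.succ.castSucc = v i.castSucc := by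
      intro Y i; rw [← Fin.succ_castSucc, Matrix.cons_val_succ]
    have hS : ∑ i : Fin p, ∑ j ≥ i.succ, (-1 : ℤ) ^ ((i.succ : ℕ) + j : ℕ) •
          θ (Matrix.vecCons (br (Matrix.vecCons (f • X) v i.succ.castSucc)
              (Matrix.vecCons (f • X) v j.succ))
            (j.removeNth (i.succ.castSucc.removeNth (Matrix.vecCons (f • X) v)))) =
        f * ∑ i : Fin p, ∑ j ≥ i.succ, (-1 : ℤ) ^ ((i.succ : ℕ) + j : ℕ) •
          θ (Matrix.vecCons (br (Matrix.vecCons X v i.succ.castSucc)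
              (Matrix.vecCons X v j.succ))
            (j.removeNth (i.succ.castSucc.removeNth (Matrix.vecCons X v)))) := by
      rw [Finset.mul_sum]
      refine Finset.sum_congr rfl fun i _ => ?_
      rw [Finset.mul_sum]
      refine Finset.sum_congr rfl fun j hj => ?_
      rw [hh, hh, Matrix.cons_val_succ, Matrix.cons_val_succ, h3 i j (Finset.mem_Ici.1 hj),
        mul_smul_comm]
    have hI : Finset.Ici (0 : Fin (p + 1)) = Finset.univ := by ext; simp
    have hE : ∀ Y : L, koszulFun ρ (fun X Y => br X Y) (p + 1) θ (Matrix.vecCons Y v) =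
        (ρ Y (θ v) + ∑ i : Fin (p + 1), (-1 : ℤ) ^ ((i : ℕ) + 1) •
          ρ (v i) (θ (i.succ.removeNth (Matrix.vecCons Y v)))) -
        (∑ j : Fin (p + 1), (-1 : ℤ) ^ (j : ℕ) •
            θ (Matrix.vecCons (br Y (v j)) (j.removeNth v)) +
          ∑ i : Fin p, ∑ j ≥ i.succ, (-1 : ℤ) ^ ((i.succ : ℕ) + j : ℕ) •
          θ (Matrix.vecCons (br (Matrix.vecCons Y v i.succ.castSucc)
              (Matrix.vecCons Y v j.succ))
            (j.removeNth (i.succ.castSucc.removeNth (Matrix.vecCons Y v))))) := by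
      intro Y
      simp only [koszulFun]
      congr 1
      · rw [Fin.sum_univ_succ]
        simp [h0]
      · rw [Fin.sum_univ_succ, hI]
        simp [h0]
    rw [hE, hE, hS]
    simp only [h1, h2, smul_sub, smul_add, Finset.sum_add_distrib, Finset.sum_sub_distrib,
      pow_succ, map_smul, Derivation.smul_apply, smul_eq_mul, mul_neg, mul_one, neg_smul,
      Finset.sum_neg_distrib, mul_sub, mul_add, Finset.mul_sum, mul_smul_comm]
    ring

theorem koszulFun_add {p : ℕ} (θ η : L [⋀^Fin p]→ₗ[A] A) (v : Fin (p + 1) → L) :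
    koszulFun ρ (fun X Y => br X Y) p (θ + η) v =
      koszulFun ρ (fun X Y => br X Y) p θ v + koszulFun ρ (fun X Y => br X Y) p η v := by
  cases p with
  | zero => simp [koszulFun]
  | succ p =>
    simp only [koszulFun, AlternatingMap.add_apply, map_add, smul_add, Finset.sum_add_distrib]
    abel

theorem koszulFun_smul {p : ℕ} (c : ℝ) (θ : L [⋀^Fin p]→ₗ[A] A) (v : Fin (p + 1) → L) :
    koszulFun ρ (fun X Y => br X Y) p (c • θ) v =
      c • koszulFun ρ (fun X Y => br X Y) p θ v := by
  cases p with
  | zero => simp [koszulFun]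
  | succ p =>
    simp only [koszulFun, AlternatingMap.smul_apply, Derivation.map_smul, smul_sub,
      Finset.smul_sum, smul_comm c]

/-- The differential of a Lie algebroid: the operator `D : Ω^p → Ω^(p+1)` given by the Koszul
formula `koszulFun`. -/
def koszul (hbr : ∀ X, br X X = 0)
    (hleib : ∀ (X Y : L) (f : A), br X (f • Y) = f • br X Y + ρ X f • Y) (p : ℕ) :
    (L [⋀^Fin p]→ₗ[A] A) →ₗ[ℝ] (L [⋀^Fin (p + 1)]→ₗ[A] A) where
  toFun θ :=
    { toFun := koszulFun ρ (fun X Y => br X Y) p θ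
      map_update_add' := by
        intro dec v i X Y
        have := (koszulReal ρ br θ).map_update_add v i X Y
        simp only [koszulReal_apply ρ br hbr] at this
        convert! this
      map_update_smul' := by
        intro dec v i f X
        obtain rfl : dec = instDecidableEqFin (p + 1) := Subsingleton.elim _ _
        have key : ∀ Y : L, koszulFun ρ (fun X Y => br X Y) p θ (Function.update v i Y) =
            (-1 : ℤ) ^ (i : ℕ) • koszulFun ρ (fun X Y => br X Y) p θ
              (Matrix.vecCons Y (i.removeNth v)) := by
          intro Y
          simp only [← koszulReal_apply ρ br hbr]
          rw [← Fin.insertNth_removeNth, AlternatingMap.map_insertNth]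
        rw [key, key, koszulFun_cons_smul ρ br hbr hleib, smul_eq_mul, mul_smul_comm]
      map_eq_zero_of_eq' := by
        intro v i j h hij
        rw [← koszulReal_apply ρ br hbr]
        exact (koszulReal ρ br θ).map_eq_zero_of_eq v h hij }
  map_add' θ η := by
    ext v : 1
    exact koszulFun_add ρ br θ η v
  map_smul' c θ := by
    ext v : 1
    exact koszulFun_smul ρ br c θ v

@[simp] theorem koszul_apply (hbr : ∀ X, br X X = 0)
    (hleib : ∀ (X Y : L) (f : A), br X (f • Y) = f • br X Y + ρ X f • Y) (p : ℕ)
    (θ : L [⋀^Fin p]→ₗ[A] A) (v : Fin (p + 1) → L) :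
    koszul ρ br hbr hleib p θ v = koszulFun ρ (fun X Y => br X Y) p θ v := rfl

end Koszul

section Algebroid

variable {n : ℕ} {M : Type*} [TopologicalSpace M] [ChartedSpace (EuclideanSpace ℝ (Fin n)) M]
  [IsManifold (𝓡 n) ∞ M]

/-- A Lie algebroid structure on a vector bundle `E` over `M`, expressed on the `C^∞(M)`-module
`L = Γ(E)` of its smooth sections: an anchor (a bundle map `E → TM` over `M`, that is, a
`C^∞(M)`-linear map `Γ(E) → Γ(TM)`), and a Lie bracket on `Γ(E)` satisfying the Leibniz rule. -/
@[ext] structure LieAlgebroid (n : ℕ) (M : Type*) [TopologicalSpace M]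
    [ChartedSpace (EuclideanSpace ℝ (Fin n)) M] [IsManifold (𝓡 n) ∞ M]
    (L : Type*) [AddCommGroup L] [Module (Fun n M) L] [Module ℝ L] where
  /-- The anchor. -/
  anchor : L →ₗ[Fun n M] VF n M
  /-- The bracket. -/
  bracket : L →ₗ[ℝ] L →ₗ[ℝ] L
  bracket_self : ∀ X, bracket X X = 0
  jacobi : ∀ X Y Z,
    bracket X (bracket Y Z) = bracket (bracket X Y) Z + bracket Y (bracket X Z)
  leibniz : ∀ (X Y : L) (f : Fun n M),
    bracket X (f • Y) = f • bracket X Y + dirDeriv (anchor X) f • Y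

variable {L : Type*} [AddCommGroup L] [Module (Fun n M) L] [Module ℝ L]
  [IsScalarTower ℝ (Fun n M) L]

/-- For `L = Γ(E)`, the smooth sections of `Λ^p E^*`, as the `C^∞(M)`-multilinear alternating maps
`Γ(E)^p → C^∞(M)`. -/
abbrev Form (n : ℕ) (M : Type*) [TopologicalSpace M]
    [ChartedSpace (EuclideanSpace ℝ (Fin n)) M] [IsManifold (𝓡 n) ∞ M]
    (L : Type*) [AddCommGroup L] [Module (Fun n M) L] (p : ℕ) :=
  L [⋀^Fin p]→ₗ[Fun n M] (Fun n M)

/-- A smooth function as a form of degree `0`. -/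
abbrev Form.ofFun (f : Fun n M) : Form n M L 0 :=
  AlternatingMap.constOfIsEmpty (Fun n M) L (Fin 0) f

/-- The wedge product of forms (with the sum over shuffles). -/
def Form.wedge {p r : ℕ} (α : Form n M L p) (β : Form n M L r) : Form n M L (p + r) :=
  ((LinearMap.mul' (Fun n M) (Fun n M)).compAlternatingMap (α.domCoprod β)).domDomCongr
    finSumFinEquiv

/-- Transport of a form along an equality of degrees. -/
def Form.cast {p r : ℕ} (h : p = r) (α : Form n M L p) : Form n M L r :=
  α.domDomCongr (finCongr h)

namespace LieAlgebroid

/-- The differential `D : Γ(Λ^p E^*) → Γ(Λ^(p+1) E^*)` of a Lie algebroid. -/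
def differential (𝓐 : LieAlgebroid n M L) (p : ℕ) : Form n M L p →ₗ[ℝ] Form n M L (p + 1) :=
  koszul (dirDeriv ∘ₗ 𝓐.anchor) 𝓐.bracket 𝓐.bracket_self 𝓐.leibniz p

theorem differential_apply (𝓐 : LieAlgebroid n M L) (p : ℕ) (θ : Form n M L p)
    (v : Fin (p + 1) → L) : 𝓐.differential p θ v =
      koszulFun (fun X => dirDeriv (𝓐.anchor X)) (fun X Y => 𝓐.bracket X Y) p θ v := rfl

/-- `D` is the operator associated to the Lie algebroid: `Df(X) = q(X) f`,
`Dα(X, Y) = q(X) (α(Y)) - q(Y) (α(X)) - α([X, Y])`, and `D` is a derivation of degree `1`. -/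
structure IsAssociatedOperator (𝓐 : LieAlgebroid n M L)
    (D : ∀ p, Form n M L p →ₗ[ℝ] Form n M L (p + 1)) : Prop where
  on_functions : ∀ (f : Fun n M) (X : L),
    D 0 (Form.ofFun f) ![X] = dirDeriv (𝓐.anchor X) f
  on_one_forms : ∀ (α : Form n M L 1) (X Y : L),
    D 1 α ![X, Y] = dirDeriv (𝓐.anchor X) (α ![Y]) - dirDeriv (𝓐.anchor Y) (α ![X])
      - α ![𝓐.bracket X Y]
  derivation : ∀ (p r : ℕ) (α : Form n M L p) (β : Form n M L r),
    D (p + r) (α.wedge β) =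
      Form.cast (by omega) ((D p α).wedge β) + (-1 : ℝ) ^ p • α.wedge (D r β)

/-- The restriction of a Lie algebroid to a submodule `S` of sections (the sections of a
subbundle) that is closed under the bracket. -/
def restrict (𝓐 : LieAlgebroid n M L) (S : Submodule (Fun n M) L)
    (hS : ∀ X ∈ S, ∀ Y ∈ S, 𝓐.bracket X Y ∈ S) : LieAlgebroid n M S where
  anchor := 𝓐.anchor ∘ₗ S.subtype
  bracket := LinearMap.mk₂ ℝ (fun X Y => ⟨𝓐.bracket X Y, hS X X.2 Y Y.2⟩)
    (fun X X' Y => Subtype.ext (by simp)) (fun c X Y => Subtype.ext (by simp))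
    (fun X Y Y' => Subtype.ext (by simp)) (fun c X Y => Subtype.ext (by simp))
  bracket_self X := Subtype.ext (𝓐.bracket_self X)
  jacobi X Y Z := Subtype.ext (𝓐.jacobi X Y Z)
  leibniz X Y f := Subtype.ext (𝓐.leibniz X Y f)

end LieAlgebroid

variable (n M) in
/-- The tangent Lie algebroid `(TM, Id, [·, ·])`. -/
def tangentAlgebroid : LieAlgebroid n M (VF n M) where
  anchor := LinearMap.id
  bracket := lieBr
  bracket_self := lieBr_self
  jacobi := lieBr_jacobi
  leibniz := lieBr_leibniz

variable (n M) in
/-- The exterior differential `d` of `M`, i.e. the differential of the tangent Lie algebroid. -/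
abbrev extD (p : ℕ) : Form n M (VF n M) p →ₗ[ℝ] Form n M (VF n M) (p + 1) :=
  (tangentAlgebroid n M).differential p

end Algebroid

section Foliation

variable {n : ℕ} {M : Type*} [TopologicalSpace M] [ChartedSpace (EuclideanSpace ℝ (Fin n)) M]
  [IsManifold (𝓡 n) ∞ M]

/-- A regular foliation of `M`, given by its tangent distribution `TF ⊆ TM`: around every point
there is a flat (foliated) chart `φ` of `M`, which carries `TF` to the constant distribution of a
fixed linear subspace `W` of the model space. The plaques of the foliation in such a chart are the
slices of `φ` parallel to `W`. The rank is only required to be locally constant. -/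
structure RegularFoliation (n : ℕ) (M : Type*) [TopologicalSpace M]
    [ChartedSpace (EuclideanSpace ℝ (Fin n)) M] [IsManifold (𝓡 n) ∞ M] where
  /-- The tangent spaces `T_x F`. -/
  tangent : ∀ x : M, Submodule ℝ (TangentSpace (𝓡 n) x)
  exists_flat_chart : ∀ x : M, ∃ φ ∈ IsManifold.maximalAtlas (𝓡 n) ∞ M, x ∈ φ.source ∧
    ∃ W : Submodule ℝ (EuclideanSpace ℝ (Fin n)), ∀ y ∈ φ.source, ∀ v : TangentSpace (𝓡 n) y,
      v ∈ tangent y ↔ mfderiv (𝓡 n) (𝓡 n) φ y v ∈ W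

theorem fderiv_mem_of_eventually_mem {E : Type*} [NormedAddCommGroup E] [InnerProductSpace ℝ E]
    [FiniteDimensional ℝ E] (W : Submodule ℝ E) (g : E → E) (e : E)
    (hg : ∀ᶠ z in nhds e, g z ∈ W) (v : E) : fderivWithin ℝ g Set.univ e v ∈ W := by
  rw [fderivWithin_univ]
  by_cases hd : DifferentiableAt ℝ g e
  · have h1 : g =ᶠ[nhds e] fun z => W.starProjection (g z) := by
      filter_upwards [hg] with z hz
      exact (W.starProjection_eq_self_iff.2 hz).symm
    rw [h1.fderiv_eq]
    have h2 : fderiv ℝ (fun z => W.starProjection (g z)) e = W.starProjection ∘L fderiv ℝ g e :=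
      (W.starProjection.hasFDerivAt.comp e hd.hasFDerivAt).fderiv
    rw [h2]
    exact W.starProjection_apply_mem _
  · rw [fderiv_zero_of_not_differentiableAt hd]
    exact W.zero_mem

/-- The vector fields tangent to a foliation are closed under the Lie bracket. -/
theorem RegularFoliation.lieBr_mem (F : RegularFoliation n M) {X Y : VF n M}
    (hX : ∀ x, X x ∈ F.tangent x) (hY : ∀ x, Y x ∈ F.tangent x) (x : M) :
    lieBr X Y x ∈ F.tangent x := by
  obtain ⟨φ, hφ, hx, W, hW⟩ := F.exists_flat_chart x
  rw [hW x hx, lieBr_apply]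
  have i2 : IsManifold (𝓡 n) (minSmoothness ℝ 2) M :=
    IsManifold.of_le (n := ∞) (by simp; exact ENat.LEInfty.out)
  have hcφ := contMDiffOn_of_mem_maximalAtlas hφ
  have hcs := contMDiffOn_symm_of_mem_maximalAtlas hφ
  have hmd : φ.MDifferentiable (𝓡 n) (𝓡 n) :=
    ⟨hcφ.mdifferentiableOn (by simp), hcs.mdifferentiableOn (by simp)⟩
  have hinv : ∀ e ∈ φ.target, (mfderiv (𝓡 n) (𝓡 n) φ.symm e).inverse =
      mfderiv (𝓡 n) (𝓡 n) φ (φ.symm e) := by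
    intro e he
    refine ContinuousLinearMap.inverse_eq ?_ ?_
    · have := hmd.symm_comp_deriv (φ.map_target he)
      rwa [φ.right_inv he] at this
    · exact hmd.comp_symm_deriv he
  have hpull : ∀ Z : VF n M, (∀ x, Z x ∈ F.tangent x) → ∀ᶠ e in nhds (φ x),
      VectorField.mpullback (𝓡 n) (𝓡 n) φ.symm Z e ∈ W := by
    intro Z hZ
    filter_upwards [φ.open_target.mem_nhds (φ.map_source hx)] with e he
    rw [VectorField.mpullback_apply, hinv e he]
    exact (hW _ (φ.map_target he) _).1 (hZ _)
  have key := VectorField.mpullback_mlieBracket (I := 𝓡 n) (I' := 𝓡 n) (f := φ.symm)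
    (x₀ := φ x) (V := X) (W := Y) (n := ∞) (X.mdiff _) (Y.mdiff _)
    (hcs.contMDiffAt (φ.open_target.mem_nhds (φ.map_source hx))) (by simp; exact ENat.LEInfty.out)
  rw [VectorField.mpullback_apply, hinv _ (φ.map_source hx), φ.left_inv hx] at key
  have h1 := fderiv_mem_of_eventually_mem W _ _ (hpull Y hY)
    (VectorField.mpullback (𝓡 n) (𝓡 n) φ.symm X (φ x))
  have h2 := fderiv_mem_of_eventually_mem W _ _ (hpull X hX)
    (VectorField.mpullback (𝓡 n) (𝓡 n) φ.symm Y (φ x))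
  rw [key, ← VectorField.mlieBracketWithin_univ,
    VectorField.mlieBracketWithin_eq_lieBracketWithin]
  exact W.sub_mem h1 h2

namespace RegularFoliation

variable (F : RegularFoliation n M)

/-- The module `Γ(TF)` of smooth vector fields tangent to the foliation. -/
def sections : Submodule (Fun n M) (VF n M) where
  carrier := {X | ∀ x, X x ∈ F.tangent x}
  add_mem' hX hY x := (F.tangent x).add_mem (hX x) (hY x)
  zero_mem' x := (F.tangent x).zero_mem
  smul_mem' f _ hX x := (F.tangent x).smul_mem (f x) (hX x)

/-- The Lie algebroid of the foliation: the bundle `TF` with the restriction of the Lie bracket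
and the inclusion `TF → TM` as anchor. -/
def algebroid : LieAlgebroid n M F.sections where
  anchor := F.sections.subtype
  bracket := LinearMap.mk₂ ℝ (fun X Y => ⟨lieBr (X : VF n M) Y, F.lieBr_mem X.2 Y.2⟩)
    (fun X X' Y => Subtype.ext (by simp)) (fun c X Y => Subtype.ext (by simp))
    (fun X Y Y' => Subtype.ext (by simp)) (fun c X Y => Subtype.ext (by simp))
  bracket_self X := Subtype.ext (lieBr_self (X : VF n M))
  jacobi X Y Z := Subtype.ext (lieBr_jacobi (X : VF n M) Y Z)
  leibniz X Y f := Subtype.ext (lieBr_leibniz (X : VF n M) Y f)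

/-- The foliated exterior differential `d_F : Γ(Λ^p T^*F) → Γ(Λ^(p+1) T^*F)`. -/
abbrev foliatedD (p : ℕ) : Form n M F.sections p →ₗ[ℝ] Form n M F.sections (p + 1) :=
  F.algebroid.differential p

end RegularFoliation

/-- An Ehresmann connection complementary to the foliation `F`, given by the associated smooth
projection `γ` of `TM` onto `TF`, a vector-valued 1-form; the horizontal bundle is `H = ker γ`. -/
structure EhresmannConnection (F : RegularFoliation n M) where
  /-- The projection, as a smooth section of the bundle `End(TM)`. -/
  γ : Cₛ^∞⟮𝓡 n; EuclideanSpace ℝ (Fin n) →L[ℝ] EuclideanSpace ℝ (Fin n),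
    (fun x : M => TangentSpace (𝓡 n) x →L[ℝ] TangentSpace (𝓡 n) x)⟯
  idem : ∀ (x : M) (v : TangentSpace (𝓡 n) x), γ x (γ x v) = γ x v
  range_eq : ∀ x : M, (γ x).range = F.tangent x

namespace EhresmannConnection

variable {F : RegularFoliation n M} (c : EhresmannConnection F)

/-- The action of `γ` on vector fields. -/
def proj : VF n M →ₗ[Fun n M] VF n M where
  toFun X := ⟨fun x => c.γ x (X x), c.γ.contMDiff.clm_bundle_apply X.contMDiff⟩
  map_add' X Y := by ext1 x; exact map_add (c.γ x) (X x) (Y x)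
  map_smul' f X := by ext1 x; exact map_smul (c.γ x) (f x) (X x)

theorem proj_mem (X : VF n M) : c.proj X ∈ F.sections := fun x => by
  rw [← c.range_eq x]; exact ⟨X x, rfl⟩

theorem proj_proj (X : VF n M) : c.proj (c.proj X) = c.proj X := by
  ext1 x; exact c.idem x (X x)

theorem proj_of_mem {X : VF n M} (hX : X ∈ F.sections) : c.proj X = X := by
  ext1 x
  have h : X x ∈ (c.γ x).range := by rw [c.range_eq x]; exact hX x
  obtain ⟨v, hv⟩ := h
  change c.γ x (X x) = X x
  rw [← hv]
  exact c.idem x v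

/-- The module `Γ(H)` of horizontal vector fields. -/
def horizontal : Submodule (Fun n M) (VF n M) := LinearMap.ker c.proj

/-- `γ` as a map `Γ(TM) → Γ(TF)`. -/
def projF : VF n M →ₗ[Fun n M] F.sections := c.proj.codRestrict F.sections c.proj_mem

/-- The contracted bracket `[X, Y]_γ = [γX, Y] + [X, γY] - γ[X, Y]`. -/
def contractedBr (X Y : VF n M) : VF n M :=
  lieBr (c.proj X) Y + lieBr X (c.proj Y) - c.proj (lieBr X Y)

/-- The Nijenhuis torsion `T_γ(X, Y) = [γX, γY] - γ[γX, Y] - γ[X, γY] + γ²[X, Y]`. -/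
def torsion (X Y : VF n M) : VF n M :=
  lieBr (c.proj X) (c.proj Y) - c.proj (lieBr (c.proj X) Y) - c.proj (lieBr X (c.proj Y))
    + c.proj (c.proj (lieBr X Y))

theorem contractedBr_add_torsion (X Y : VF n M) :
    c.contractedBr X Y + c.torsion X Y = lieBr (c.proj X) (c.proj Y)
      + ((lieBr (c.proj X) Y + lieBr X (c.proj Y))
        - c.proj (lieBr (c.proj X) Y + lieBr X (c.proj Y))) := by
  simp only [contractedBr, torsion, c.proj_proj, map_add]
  abel

theorem proj_lieBr (X Y : VF n M) :
    c.proj (lieBr (c.proj X) (c.proj Y)) = lieBr (c.proj X) (c.proj Y) :=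
  c.proj_of_mem (F.lieBr_mem (c.proj_mem X) (c.proj_mem Y))

theorem proj_real_smul (r : ℝ) (X : VF n M) : c.proj (r • X) = r • c.proj X :=
  LinearMap.map_smul_of_tower _ _ _

/-- The bracket `[X, Y]_γ + T_γ(X, Y)` on vector fields. -/
def bracket : VF n M →ₗ[ℝ] VF n M →ₗ[ℝ] VF n M :=
  LinearMap.mk₂ ℝ (fun X Y => c.contractedBr X Y + c.torsion X Y)
    (fun X X' Y => by
      simp only [contractedBr_add_torsion, map_add, LinearMap.add_apply]; abel)
    (fun r X Y => by
      simp only [contractedBr_add_torsion, map_add, proj_real_smul, map_smul,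
        LinearMap.smul_apply, smul_add, smul_sub])
    (fun X Y Y' => by
      simp only [contractedBr_add_torsion, map_add]; abel)
    (fun r X Y => by
      simp only [contractedBr_add_torsion, map_add, proj_real_smul, map_smul, smul_add,
        smul_sub])

theorem bracket_apply (X Y : VF n M) : c.bracket X Y = c.contractedBr X Y + c.torsion X Y := rfl

theorem bracket_eq (X Y : VF n M) :
    c.bracket X Y = lieBr (c.proj X) (c.proj Y)
      + ((lieBr (c.proj X) Y + lieBr X (c.proj Y))
        - c.proj (lieBr (c.proj X) Y + lieBr X (c.proj Y))) :=
  c.contractedBr_add_torsion X Y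

theorem proj_bracket (X Y : VF n M) :
    c.proj (c.bracket X Y) = lieBr (c.proj X) (c.proj Y) := by
  rw [bracket_eq, map_add, map_sub, proj_proj, sub_self, add_zero, proj_lieBr]

theorem lieBr_swap (X Y : VF n M) : lieBr Y X = - lieBr X Y := by
  have := lieBr_self (X + Y)
  simp only [map_add, LinearMap.add_apply, lieBr_self] at this
  rw [zero_add, add_zero] at this
  exact eq_neg_of_add_eq_zero_left this

theorem bracket_self (X : VF n M) : c.bracket X X = 0 := by
  rw [bracket_eq, lieBr_self, lieBr_swap X (c.proj X), neg_add_cancel]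
  simp

theorem bracket_bracket (X Y Z : VF n M) :
    c.bracket X (c.bracket Y Z) = lieBr (c.proj X) (lieBr (c.proj Y) (c.proj Z)) +
      ((lieBr (c.proj X) (lieBr (c.proj Y) Z) + lieBr (c.proj X) (lieBr Y (c.proj Z)) +
          lieBr X (lieBr (c.proj Y) (c.proj Z))) -
        c.proj (lieBr (c.proj X) (lieBr (c.proj Y) Z) + lieBr (c.proj X) (lieBr Y (c.proj Z)) +
          lieBr X (lieBr (c.proj Y) (c.proj Z)))) := by
  have h1 : c.proj (lieBr (c.proj X) (lieBr (c.proj Y) (c.proj Z))) =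
      lieBr (c.proj X) (lieBr (c.proj Y) (c.proj Z)) := by
    rw [← c.proj_lieBr Y Z, proj_lieBr]
  have h2 := c.proj_lieBr X (lieBr (c.proj Y) Z)
  have h3 := c.proj_lieBr X (lieBr Y (c.proj Z))
  rw [bracket_eq c X, proj_bracket, bracket_eq c Y Z]
  simp only [map_add, map_sub, h1, h2, h3]
  abel

theorem bracket_swap (X Y : VF n M) : c.bracket Y X = - c.bracket X Y := by
  have := c.bracket_self (X + Y)
  simp only [map_add, LinearMap.add_apply, bracket_self] at this
  rw [zero_add, add_zero] at this
  exact eq_neg_of_add_eq_zero_left this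

theorem lieBr_jacobi' (X Y Z : VF n M) :
    lieBr X (lieBr Y Z) = - lieBr Z (lieBr X Y) + lieBr Y (lieBr X Z) := by
  rw [lieBr_jacobi X Y Z, lieBr_swap Z (lieBr X Y)]

theorem bracket_jacobi (X Y Z : VF n M) :
    c.bracket X (c.bracket Y Z) = c.bracket (c.bracket X Y) Z + c.bracket Y (c.bracket X Z) := by
  rw [c.bracket_swap Z (c.bracket X Y), bracket_bracket, bracket_bracket, bracket_bracket,
    lieBr_jacobi' (c.proj X) (c.proj Y) (c.proj Z), lieBr_jacobi' (c.proj X) (c.proj Y) Z,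
    lieBr_jacobi' (c.proj X) Y (c.proj Z), lieBr_jacobi' X (c.proj Y) (c.proj Z)]
  simp only [map_add, map_neg]
  abel

theorem bracket_leibniz (X Y : VF n M) (f : Fun n M) :
    c.bracket X (f • Y) = f • c.bracket X Y + dirDeriv (c.proj X) f • Y := by
  simp only [bracket_eq, map_smul, lieBr_leibniz, map_add, smul_add, smul_sub, proj_proj]
  abel

/-- The Lie algebroid on `TM` with anchor `γ` and bracket `[X, Y]_γ + T_γ(X, Y)`. -/
def algebroid : LieAlgebroid n M (VF n M) where
  anchor := c.proj
  bracket := c.bracket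
  bracket_self := c.bracket_self
  jacobi := c.bracket_jacobi
  leibniz := c.bracket_leibniz

/-- A form is of type `(a, b)` if it has degree `a + b` and vanishes whenever more than `b` of
its arguments lie in `Γ(TF)`, or more than `a` lie in `Γ(H)`. -/
def IsOfType {p : ℕ} (a b : ℤ) (θ : Form n M (VF n M) p) : Prop :=
  a + b = p ∧ ∀ (v : Fin p → VF n M) (S : Finset (Fin p)),
    ((∀ i ∈ S, v i ∈ F.sections) → b < S.card → θ v = 0) ∧
    ((∀ i ∈ S, v i ∈ c.horizontal) → a < S.card → θ v = 0)

/-- `γ` for positions in `S`, `Id - γ` for the others. -/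
def sel {p : ℕ} (S : Finset (Fin p)) (i : Fin p) : VF n M →ₗ[Fun n M] VF n M :=
  if i ∈ S then c.proj else LinearMap.id - c.proj

/-- The component of type `(p - b, b)` of a form of degree `p`: the sum, over all sets `S` of `b`
positions, of the forms obtained by inserting the `TF`-parts of the arguments in the positions
in `S` and the `H`-parts of the arguments in the other positions. -/
def typePart (b : ℤ) {p : ℕ} (θ : Form n M (VF n M) p) : Form n M (VF n M) p where
  toMultilinearMap := ∑ S : Finset (Fin p) with (S.card : ℤ) = b,
    θ.toMultilinearMap.compLinearMap (c.sel S)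
  map_eq_zero_of_eq' := by
    intro v i j hv hij
    have hsel : ∀ (S : Finset (Fin p)) (k : Fin p),
        c.sel (S.map (Equiv.swap i j).toEmbedding) k = c.sel S (Equiv.swap i j k) := by
      intro S k
      simp [sel, Finset.mem_map_equiv]
    have hvs : ∀ k, v (Equiv.swap i j k) = v k := by
      intro k
      rcases eq_or_ne k i with rfl | hki
      · simp [hv]
      rcases eq_or_ne k j with rfl | hkj
      · simp [hv]
      · rw [Equiv.swap_apply_of_ne_of_ne hki hkj]
    have happ : ∀ u : Fin p → VF n M,
        (∑ S : Finset (Fin p) with (S.card : ℤ) = b,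
          θ.toMultilinearMap.compLinearMap (c.sel S)) u =
        ∑ S : Finset (Fin p) with (S.card : ℤ) = b, θ fun k => c.sel S k (u k) := by
      intro u
      simp
    have hsum : ∀ S : Finset (Fin p),
        (θ fun k => c.sel (S.map (Equiv.swap i j).toEmbedding) k (v k)) =
          - θ fun k => c.sel S k (v k) := by
      intro S
      have h1 := θ.map_swap (fun k => c.sel S k (v k)) hij
      rw [← h1]
      congr 1
      funext k
      rw [hsel, Function.comp_apply, hvs]
    refine (happ v).trans (Finset.sum_involution
      (fun S _ => S.map (Equiv.swap i j).toEmbedding) ?_ ?_ ?_ ?_)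
    · intro S _
      rw [hsum, add_neg_cancel]
    · intro S _ hne heq
      apply hne
      refine θ.map_eq_zero_of_eq _ ?_ hij
      have h2 := hsel S i
      rw [heq, Equiv.swap_apply_left] at h2
      simp only [h2, hv]
    · intro S hS
      simpa using hS
    · intro S _
      ext k
      simp [Finset.mem_map_equiv]

theorem typePart_apply (b : ℤ) {p : ℕ} (θ : Form n M (VF n M) p) (v : Fin p → VF n M) :
    c.typePart b θ v =
      ∑ S : Finset (Fin p) with (S.card : ℤ) = b, θ fun i => c.sel S i (v i) := by
  change (∑ S : Finset (Fin p) with (S.card : ℤ) = b,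
    θ.toMultilinearMap.compLinearMap (c.sel S)) v = _
  simp

/-- `typePart` as a linear map. -/
def typePartL (b : ℤ) (p : ℕ) : Form n M (VF n M) p →ₗ[ℝ] Form n M (VF n M) p where
  toFun := c.typePart b
  map_add' θ η := by ext v : 1; simp [typePart_apply, Finset.sum_add_distrib]
  map_smul' r θ := by ext v : 1; simp [typePart_apply, Finset.smul_sum]

/-- The component `d_{1-j,j}` of the exterior differential, which maps forms of type `(a, b)` to
forms of type `(a + 1 - j, b + j)`: the sum over `b` of the composites
`Ω^p → Ω^{p-b,b} → Ω^{p+1} → Ω^{p+1-b-j,b+j}` of the projections with `d`. -/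
def dComponent (j : ℤ) (p : ℕ) : Form n M (VF n M) p →ₗ[ℝ] Form n M (VF n M) (p + 1) :=
  ∑ b ∈ Finset.range (p + 1), c.typePartL (b + j) (p + 1) ∘ₗ extD n M p ∘ₗ c.typePartL b p

/-- The component `d_{0,1}` of the exterior differential. -/
abbrev d01 (p : ℕ) : Form n M (VF n M) p →ₗ[ℝ] Form n M (VF n M) (p + 1) := c.dComponent 1 p

/-- The component `d_{1,0}` of the exterior differential. -/
abbrev d10 (p : ℕ) : Form n M (VF n M) p →ₗ[ℝ] Form n M (VF n M) (p + 1) := c.dComponent 0 p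

/-- The component `d_{2,-1}` of the exterior differential. -/
abbrev d2m1 (p : ℕ) : Form n M (VF n M) p →ₗ[ℝ] Form n M (VF n M) (p + 1) := c.dComponent (-1) p

/-- `Γ(Λ^p H⁰)`, where `H⁰ ⊆ T^*M` is the annihilator of `H`: the forms which vanish as soon as
one of the arguments is horizontal. -/
def annForms (p : ℕ) : Submodule (Fun n M) (Form n M (VF n M) p) where
  carrier := {θ | ∀ v : Fin p → VF n M, (∃ i, v i ∈ c.horizontal) → θ v = 0}
  add_mem' hθ hη v hv := by simp [hθ v hv, hη v hv]
  zero_mem' v _ := rfl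
  smul_mem' f θ hθ v hv := by simp [hθ v hv]

end EhresmannConnection

end Foliation

end FoliatedAlgebroid

end

open FoliatedAlgebroid

/-
In every Lie algebroid, Cartan's formula `i_X D = L_X - D i_X` reduces identities involving `D`, by
induction on the degree of forms, to identities between Lie derivatives and contractions, and
finally between brackets: this gives `D² = 0` and the derivation rule. The same induction follows
the number `b` of arguments along `TF`. For `X` and `Z` in `TF` or `H`, the bracket `⟦X, Z⟧` lies in
`TF` when both are in `TF`, vanishes when both are in `H`, and is in `H` otherwise; hence `D` raises
`b` by exactly one. The brackets `[X, Z]` and `⟦X, Z⟧` agree on `TF` and differ by an element of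
`TF` when one argument is in `TF`; hence `d - D` changes `b` by `0` or `-1`. So `D` is the component
`d_{0,1}` of `d`. Finally `γ` is a morphism of Lie algebroids from `(TM, γ, ⟦·, ·⟧)` to `TF`, and
`h` is the pullback along it.
-/

noncomputable section

namespace FoliatedAlgebroid

section Cartan

theorem removeNth_succ_vecCons {α : Type*} {p : ℕ} (i : Fin (p + 1)) (x : α) (v : Fin (p + 1) → α) :
    i.succ.removeNth (Matrix.vecCons x v) = Matrix.vecCons x (i.removeNth v) := by
  funext l
  cases l using Fin.cases <;> simp [Fin.removeNth_apply]

variable {A L : Type*} [CommRing A] [AddCommGroup L] [Module A L]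

theorem map_update_eq_smul_map_vecCons_removeNth {p : ℕ} (θ : L [⋀^Fin (p + 1)]→ₗ[A] A)
    (v : Fin (p + 1) → L) (i : Fin (p + 1)) (Y : L) :
    θ (Function.update v i Y) = (-1 : ℤ) ^ (i : ℕ) • θ (Matrix.vecCons Y (i.removeNth v)) := by
  rw [← Fin.insertNth_removeNth, θ.map_insertNth]

theorem map_vecCons_vecCons_swap {p : ℕ} (θ : L [⋀^Fin (p + 2)]→ₗ[A] A) (X Y : L)
    (v : Fin p → L) :
    θ (Matrix.vecCons X (Matrix.vecCons Y v)) = -θ (Matrix.vecCons Y (Matrix.vecCons X v)) := by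
  have h := DFunLike.congr_fun (θ.curryLeft_same (X + Y)) v
  simp only [map_add, AlternatingMap.curryLeft_add, LinearMap.add_apply, AlternatingMap.add_apply,
    AlternatingMap.curryLeft_same, AlternatingMap.curryLeft_apply_apply,
    AlternatingMap.zero_apply, zero_add, add_zero] at h
  exact eq_neg_of_add_eq_zero_right h

theorem sum_bracket_vecCons (br : L → L → L) {p : ℕ} (θ : L [⋀^Fin (p + 1)]→ₗ[A] A) (X : L)
    (v : Fin (p + 1) → L) :
    ∑ i : Fin (p + 1), ∑ j ≥ i, (-1 : ℤ) ^ (i + j : ℕ) •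
        θ (Matrix.vecCons (br (Matrix.vecCons X v i.castSucc) (Matrix.vecCons X v j.succ))
          (j.removeNth (i.castSucc.removeNth (Matrix.vecCons X v)))) =
      ∑ j, θ (Function.update v j (br X (v j))) +
        ∑ i : Fin p, ∑ j ≥ i, (-1 : ℤ) ^ ((i : ℕ) + 1 + (j + 1)) •
          θ (Matrix.vecCons (br (v i.castSucc) (v j.succ))
            (j.succ.removeNth (i.succ.castSucc.removeNth (Matrix.vecCons X v)))) := by
  have h_Ici : Finset.Ici (0 : Fin (p + 1)) = Finset.univ := Finset.Ici_bot
  rw [Fin.sum_univ_succ, h_Ici]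
  congr 1
  · refine Finset.sum_congr rfl fun j _ => ?_
    rw [map_update_eq_smul_map_vecCons_removeNth, Fin.castSucc_zero, Fin.removeNth_zero]
    simp [Matrix.vecCons]
  · simp only [Fin.sum_Ici_succ, ← Fin.succ_castSucc, Matrix.cons_val_succ, Fin.val_succ]

variable [Algebra ℝ A]

/-- The interior product `i_X θ = θ(X, …)`, as an `ℝ`-linear map on forms. -/
def interior (X : L) {p : ℕ} : (L [⋀^Fin (p + 1)]→ₗ[A] A) →ₗ[ℝ] (L [⋀^Fin p]→ₗ[A] A) where
  toFun θ := θ.curryLeft X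
  map_add' _ _ := rfl
  map_smul' _ _ := rfl

@[simp] theorem interior_apply (X : L) {p : ℕ} (θ : L [⋀^Fin (p + 1)]→ₗ[A] A) (v : Fin p → L) :
    interior X θ v = θ (Matrix.vecCons X v) := rfl

theorem interior_add (X Y : L) {p : ℕ} (θ : L [⋀^Fin (p + 1)]→ₗ[A] A) :
    interior (X + Y) θ = interior X θ + interior Y θ :=
  map_add θ.curryLeft X Y

theorem interior_sub (X Y : L) {p : ℕ} (θ : L [⋀^Fin (p + 1)]→ₗ[A] A) :
    interior (X - Y) θ = interior X θ - interior Y θ :=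
  map_sub θ.curryLeft X Y

theorem interior_zero {p : ℕ} (θ : L [⋀^Fin (p + 1)]→ₗ[A] A) : interior 0 θ = 0 :=
  map_zero θ.curryLeft

theorem ext_interior {p : ℕ} {θ η : L [⋀^Fin (p + 1)]→ₗ[A] A}
    (h : ∀ X, interior X θ = interior X η) : θ = η := by
  ext v
  simpa only [interior_apply, Matrix.cons_head_tail] using
    DFunLike.congr_fun (h (Matrix.vecHead v)) (Matrix.vecTail v)

variable [Module ℝ L] (ρ : L →ₗ[A] Derivation ℝ A A) (br : L →ₗ[ℝ] L →ₗ[ℝ] L)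

theorem koszulFun_vecCons {p : ℕ} (θ : L [⋀^Fin (p + 1)]→ₗ[A] A) (X : L)
    (v : Fin (p + 1) → L) :
    koszulFun ρ (fun X Y => br X Y) (p + 1) θ (Matrix.vecCons X v) =
      ρ X (θ v) - ∑ j, θ (Function.update v j (br X (v j))) -
        koszulFun ρ (fun X Y => br X Y) p (interior X θ) v := by
  have anchor_sum : ∑ i : Fin (p + 2), (-1 : ℤ) ^ (i : ℕ) •
      ρ (Matrix.vecCons X v i) (θ (i.removeNth (Matrix.vecCons X v))) =
        ρ X (θ v) - ∑ i : Fin (p + 1), (-1 : ℤ) ^ (i : ℕ) •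
          ρ (v i) (interior X θ (i.removeNth v)) := by
    rw [Fin.sum_univ_succ, Fin.removeNth_zero, sub_eq_add_neg, ← Finset.sum_neg_distrib]
    simp [removeNth_succ_vecCons, pow_succ]
  rw [koszulFun, anchor_sum, sum_bracket_vecCons fun X Y => br X Y]
  cases p with
  | zero => simp [koszulFun, Subsingleton.elim (Fin.tail v) ![], sub_right_comm]
  | succ p =>
    have bracket_sum : ∑ i : Fin (p + 1), ∑ j ≥ i, (-1 : ℤ) ^ ((i : ℕ) + 1 + (j + 1)) •
        θ (Matrix.vecCons (br (v i.castSucc) (v j.succ))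
          (j.succ.removeNth (i.succ.castSucc.removeNth (Matrix.vecCons X v)))) =
        -∑ i : Fin (p + 1), ∑ j ≥ i, (-1 : ℤ) ^ (i + j : ℕ) •
          interior X θ (Matrix.vecCons (br (v i.castSucc) (v j.succ))
            (j.removeNth (i.castSucc.removeNth v))) := by
      simp only [← Finset.sum_neg_distrib, ← Fin.succ_castSucc, removeNth_succ_vecCons,
        map_vecCons_vecCons_swap θ _ X, interior_apply, ← smul_neg]
      simp only [add_add_add_comm _ 1, pow_add, even_two.neg_one_pow, one_add_one_eq_two, mul_one]
    rw [koszulFun, bracket_sum]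
    abel

variable [IsScalarTower ℝ A L] (hbr : ∀ X, br X X = 0)
  (hleib : ∀ (X Y : L) (f : A), br X (f • Y) = f • br X Y + ρ X f • Y)

/-- The Lie derivative `L_X = i_X D + D i_X` on the forms of a Lie algebroid with differential
`D`. Taking Cartan's formula as the definition makes `L_X θ` multilinear over `A` at no cost. -/
def lieDer (X : L) : (p : ℕ) → (L [⋀^Fin p]→ₗ[A] A) →ₗ[ℝ] (L [⋀^Fin p]→ₗ[A] A)
  | 0 => interior X ∘ₗ koszul ρ br hbr hleib 0
  | p + 1 => interior X ∘ₗ koszul ρ br hbr hleib (p + 1) + koszul ρ br hbr hleib p ∘ₗ interior X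

local notation "𝐃" => koszul ρ br hbr hleib
local notation "𝓛" => lieDer ρ br hbr hleib

theorem interior_koszul_zero (X : L) (θ : L [⋀^Fin 0]→ₗ[A] A) :
    interior X (𝐃 0 θ) = 𝓛 X 0 θ := rfl

theorem interior_koszul_succ (X : L) {p : ℕ} (θ : L [⋀^Fin (p + 1)]→ₗ[A] A) :
    interior X (𝐃 (p + 1) θ) = 𝓛 X (p + 1) θ - 𝐃 p (interior X θ) :=
  (add_sub_cancel_right _ _).symm

theorem lieDer_apply (X : L) {p : ℕ} (θ : L [⋀^Fin p]→ₗ[A] A) (v : Fin p → L) :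
    𝓛 X p θ v = ρ X (θ v) - ∑ j, θ (Function.update v j (br X (v j))) := by
  cases p with
  | zero => simp [lieDer, koszulFun, Subsingleton.elim v ![]]
  | succ p => simp [lieDer, koszulFun_vecCons]

theorem interior_lieDer (X Z : L) {p : ℕ} (θ : L [⋀^Fin (p + 1)]→ₗ[A] A) :
    interior Z (𝓛 X (p + 1) θ) = 𝓛 X p (interior Z θ) - interior (br X Z) θ := by
  ext v
  simp only [AlternatingMap.sub_apply, interior_apply, lieDer_apply, Fin.sum_univ_succ,
    Matrix.vecCons, Fin.cons_zero, Fin.cons_succ, Fin.update_cons_zero, Fin.cons_update]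
  abel

variable (hjac : ∀ X Y Z, br X (br Y Z) = br (br X Y) Z + br Y (br X Z))
  (hρ : ∀ X Y f, ρ (br X Y) f = ρ X (ρ Y f) - ρ Y (ρ X f))

include hjac hρ

theorem lieDer_bracket (X Y : L) {p : ℕ} (θ : L [⋀^Fin p]→ₗ[A] A) :
    𝓛 (br X Y) p θ = 𝓛 X p (𝓛 Y p θ) - 𝓛 Y p (𝓛 X p θ) := by
  induction p with
  | zero =>
    ext v
    simp [lieDer_apply, hρ]
  | succ p ih =>
    refine ext_interior fun Z => ?_
    simp only [interior_lieDer, map_sub, ih, hjac X Y Z, interior_add]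
    abel

theorem lieDer_koszul (X : L) {p : ℕ} (θ : L [⋀^Fin p]→ₗ[A] A) :
    𝓛 X (p + 1) (𝐃 p θ) = 𝐃 p (𝓛 X p θ) := by
  induction p with
  | zero =>
    refine ext_interior fun Z => ?_
    simp only [interior_lieDer, interior_koszul_zero, lieDer_bracket ρ br hbr hleib hjac hρ]
    abel
  | succ p ih =>
    refine ext_interior fun Z => ?_
    simp only [interior_lieDer, interior_koszul_succ, lieDer_bracket ρ br hbr hleib hjac hρ,
      map_sub, ih]
    abel

theorem koszul_koszul {p : ℕ} (θ : L [⋀^Fin p]→ₗ[A] A) : 𝐃 (p + 1) (𝐃 p θ) = 0 := by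
  induction p with
  | zero =>
    refine ext_interior fun Z => ?_
    rw [interior_koszul_succ, interior_koszul_zero, lieDer_koszul ρ br hbr hleib hjac hρ,
      sub_self, map_zero]
  | succ p ih =>
    refine ext_interior fun Z => ?_
    rw [interior_koszul_succ, interior_koszul_succ, lieDer_koszul ρ br hbr hleib hjac hρ,
      map_sub, ih, sub_zero, sub_self, map_zero]

end Cartan

section Wedge

theorem sum_perm_eq_sum_decomposeFin_mul_cycleRange {N : ℕ} {G : Type*} [AddCommMonoid G]
    (f : Equiv.Perm (Fin (N + 1)) → G) :
    ∑ τ, f τ = ∑ k : Fin (N + 1), ∑ e : Equiv.Perm (Fin N),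
      f (Equiv.Perm.decomposeFin.symm (0, e) * k.cycleRange) := by
  let τ : Fin (N + 1) × Equiv.Perm (Fin N) → Equiv.Perm (Fin (N + 1)) := fun x =>
    Equiv.Perm.decomposeFin.symm (0, x.2) * x.1.cycleRange
  have map_fst : ∀ x, τ x x.1 = 0 := fun x => by simp [τ]
  have bijective : Function.Bijective τ := by
    rw [Fintype.bijective_iff_injective_and_card]
    refine ⟨?_, by simp [Fintype.card_perm, Nat.factorial_succ]⟩
    rintro ⟨k, e⟩ ⟨k', e'⟩ h
    obtain rfl : k = k' := (τ (k, e)).injective ((map_fst (k, e)).trans (h ▸ (map_fst _).symm))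
    simpa using mul_right_cancel h
  rw [← Fintype.sum_prod_type', ← bijective.sum_comp]

variable {A L : Type*} [CommRing A] [AddCommGroup L] [Module A L]

theorem interior_alternatization {N : ℕ} (f : MultilinearMap A (fun _ : Fin (N + 1) => L) A)
    (X : L) : f.alternatization.curryLeft X =
      (∑ k : Fin (N + 1), (-1 : ℤ) ^ (k : ℕ) • f.curryMid k X).alternatization := by
  have vecCons_comp : ∀ (v : Fin N → L) (k : Fin (N + 1)) (e : Equiv.Perm (Fin N)),
      (fun i => Matrix.vecCons X v ((Equiv.Perm.decomposeFin.symm (0, e) * k.cycleRange) i)) =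
        k.insertNth X fun i => v (e i) := by
    intro v k e
    rw [← Fin.cons_comp_cycleRange]
    funext i
    simp only [Function.comp_apply, Equiv.Perm.mul_apply]
    cases k.cycleRange i using Fin.cases <;> simp [Equiv.Perm.decomposeFin_symm_apply_succ]
  ext v
  simp only [AlternatingMap.curryLeft_apply_apply, MultilinearMap.alternatization_apply,
    MultilinearMap.domDomCongr_apply, sum_perm_eq_sum_decomposeFin_mul_cycleRange, vecCons_comp,
    FunLike.coe_sum, Finset.sum_apply, smul_apply, MultilinearMap.curryMid_apply_apply,
    Finset.smul_sum]
  rw [Finset.sum_comm]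
  refine Finset.sum_congr rfl fun e _ => Finset.sum_congr rfl fun k _ => ?_
  simp [Fin.sign_cycleRange, mul_smul, Units.smul_def]

/-- The positions of the two factors of a product of forms, among those of the product. -/
def blockEquiv {p r N : ℕ} (h : p + r = N) : Fin p ⊕ Fin r ≃ Fin N :=
  finSumFinEquiv.trans (finCongr h)

@[simp] theorem val_blockEquiv_inl {p r N : ℕ} (h : p + r = N) (i : Fin p) :
    (blockEquiv h (.inl i) : ℕ) = i := by simp [blockEquiv]

@[simp] theorem val_blockEquiv_inr {p r N : ℕ} (h : p + r = N) (i : Fin r) :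
    (blockEquiv h (.inr i) : ℕ) = p + i := by simp [blockEquiv]

theorem insertNth_blockEquiv_inl {α : Type*} {p r N : ℕ} (h : p + 1 + r = N + 1) (h' : p + r = N)
    (i : Fin (p + 1)) (x : α) (w : Fin N → α) (l : Fin (p + 1) ⊕ Fin r) :
    (blockEquiv h (.inl i)).insertNth (α := fun _ => α) x w (blockEquiv h l) =
      Sum.elim (i.insertNth x fun l => w (blockEquiv h' (.inl l)))
        (fun l => w (blockEquiv h' (.inr l))) l := by
  have succAbove_inl (l : Fin p) : blockEquiv h (.inl (i.succAbove l)) =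
      (blockEquiv h (.inl i)).succAbove (blockEquiv h' (.inl l)) := by
    ext
    simp only [Fin.succAbove, Fin.lt_def, Fin.val_castSucc, val_blockEquiv_inl]
    split_ifs <;> simp
  have succAbove_inr (l : Fin r) : blockEquiv h (.inr l) =
      (blockEquiv h (.inl i)).succAbove (blockEquiv h' (.inr l)) := by
    ext
    rw [Fin.succAbove_of_le_castSucc _ _ (by simp [Fin.le_def]; omega)]
    simp; omega
  rcases l with l | l
  · cases l using i.succAboveCases <;> simp [succAbove_inl]
  · simp [succAbove_inr]

theorem insertNth_blockEquiv_inr {α : Type*} {p r N : ℕ} (h : p + (r + 1) = N + 1)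
    (h' : p + r = N) (i : Fin (r + 1)) (x : α) (w : Fin N → α) (l : Fin p ⊕ Fin (r + 1)) :
    (blockEquiv h (.inr i)).insertNth (α := fun _ => α) x w (blockEquiv h l) =
      Sum.elim (fun l => w (blockEquiv h' (.inl l)))
        (i.insertNth x fun l => w (blockEquiv h' (.inr l))) l := by
  have succAbove_inl (l : Fin p) : blockEquiv h (.inl l) =
      (blockEquiv h (.inr i)).succAbove (blockEquiv h' (.inl l)) := by
    ext
    rw [Fin.succAbove_of_castSucc_lt _ _ (by simp [Fin.lt_def]; omega)]
    simp
  have succAbove_inr (l : Fin r) : blockEquiv h (.inr (i.succAbove l)) =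
      (blockEquiv h (.inr i)).succAbove (blockEquiv h' (.inr l)) := by
    ext
    simp only [Fin.succAbove, Fin.lt_def, Fin.val_castSucc, val_blockEquiv_inr]
    split_ifs <;> simp <;> omega
  rcases l with l | l
  · simp [succAbove_inl]
  · cases l using i.succAboveCases <;> simp [succAbove_inr]

/-- The tensor product `α ⊗ β` of scalar-valued multilinear maps, before antisymmetrization. -/
def tensor {p r N : ℕ} (h : p + r = N) (α : MultilinearMap A (fun _ : Fin p => L) A)
    (β : MultilinearMap A (fun _ : Fin r => L) A) : MultilinearMap A (fun _ : Fin N => L) A :=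
  ((LinearMap.mul' A A).compMultilinearMap (α.domCoprod β)).domDomCongr (blockEquiv h)

theorem tensor_apply {p r N : ℕ} (h : p + r = N) (α : MultilinearMap A (fun _ : Fin p => L) A)
    (β : MultilinearMap A (fun _ : Fin r => L) A) (v : Fin N → L) :
    tensor h α β v = α (fun i => v (blockEquiv h (.inl i))) *
      β (fun i => v (blockEquiv h (.inr i))) := rfl

theorem curryMid_tensor_inl {p r N : ℕ} (h : p + 1 + r = N + 1) (h' : p + r = N)
    (α : L [⋀^Fin (p + 1)]→ₗ[A] A) (β : L [⋀^Fin r]→ₗ[A] A) (X : L) (i : Fin (p + 1)) :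
    (tensor h (α : MultilinearMap A _ A) β).curryMid (blockEquiv h (.inl i)) X =
      (-1 : ℤ) ^ (i : ℕ) • tensor h' (α.curryLeft X : MultilinearMap A _ A) β := by
  ext v
  simp [tensor_apply, insertNth_blockEquiv_inl h h', α.map_insertNth, Matrix.vecCons, mul_assoc]

theorem curryMid_tensor_inr {p r N : ℕ} (h : p + (r + 1) = N + 1) (h' : p + r = N)
    (α : L [⋀^Fin p]→ₗ[A] A) (β : L [⋀^Fin (r + 1)]→ₗ[A] A) (X : L) (i : Fin (r + 1)) :
    (tensor h (α : MultilinearMap A _ A) β).curryMid (blockEquiv h (.inr i)) X =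
      (-1 : ℤ) ^ (i : ℕ) • tensor h' (α : MultilinearMap A _ A) (β.curryLeft X) := by
  ext v
  simp [tensor_apply, insertNth_blockEquiv_inr h h', β.map_insertNth, Matrix.vecCons,
    mul_left_comm]

/-- The wedge product of forms of degrees `p` and `r` as a bilinear map. The degree of the product
is any `N` with `p + r = N`, so that no transport between degrees is needed. -/
def wedge {p r N : ℕ} (h : p + r = N) : (L [⋀^Fin p]→ₗ[A] A) →ₗ[A] (L [⋀^Fin r]→ₗ[A] A) →ₗ[A]
    (L [⋀^Fin N]→ₗ[A] A) :=
  (TensorProduct.mk A _ _).compr₂ ((AlternatingMap.domDomCongrₗ A (blockEquiv h)).toLinearMap ∘ₗ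
    LinearMap.compAlternatingMapₗ A (LinearMap.mul' A A) ∘ₗ AlternatingMap.domCoprod')

theorem alternatization_domDomCongr {ι κ : Type*} [Fintype ι] [DecidableEq ι] [Fintype κ]
    [DecidableEq κ] (e : ι ≃ κ) (f : MultilinearMap A (fun _ : ι => L) A) :
    (f.domDomCongr e).alternatization = f.alternatization.domDomCongr e := by
  ext v
  simp [MultilinearMap.alternatization_apply, ← Equiv.sum_comp e.permCongr]

theorem factorial_smul_wedge {p r N : ℕ} (h : p + r = N) (α : L [⋀^Fin p]→ₗ[A] A)
    (β : L [⋀^Fin r]→ₗ[A] A) : (p.factorial * r.factorial) • wedge h α β =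
      (tensor h (α : MultilinearMap A _ A) β).alternatization := by
  rw [tensor, alternatization_domDomCongr, LinearMap.compMultilinearMap_alternatization,
    MultilinearMap.domCoprod_alternization_eq]
  ext v
  simp [wedge]

theorem wedge_apply_of_isEmpty (h : 0 + 0 = 0) (α β : L [⋀^Fin 0]→ₗ[A] A) (v : Fin 0 → L) :
    wedge h α β v = α v * β v := by
  have := DFunLike.congr_fun (factorial_smul_wedge h α β) v
  simpa [MultilinearMap.alternatization_apply, tensor_apply, Subsingleton.elim _ v] using this

variable [Algebra ℝ A]

theorem eq_of_nsmul_eq_nsmul {G : Type*} [AddCommGroup G] [Module ℝ G] {m : ℕ} (hm : m ≠ 0)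
    {x y : G} (h : m • x = m • y) : x = y := by
  simp only [← Nat.cast_smul_eq_nsmul ℝ] at h
  exact smul_right_injective G (Nat.cast_ne_zero.2 hm) h

theorem factorial_smul_interior_wedge {p r N : ℕ} (h : p + r = N + 1) (X : L)
    (α : L [⋀^Fin p]→ₗ[A] A) (β : L [⋀^Fin r]→ₗ[A] A) :
    (p.factorial * r.factorial) • interior X (wedge h α β) =
      (∑ l, (-1 : ℤ) ^ (blockEquiv h l : ℕ) •
        (tensor h (α : MultilinearMap A _ A) β).curryMid (blockEquiv h l) X).alternatization := by
  rw [Equiv.sum_comp (blockEquiv h) fun k => (-1 : ℤ) ^ (k : ℕ) •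
    (tensor h (α : MultilinearMap A _ A) β).curryMid k X, ← interior_alternatization,
    ← factorial_smul_wedge]
  rfl

theorem alternatization_sum_curryMid_tensor_inl {p r N : ℕ} (h : p + 1 + r = N + 1)
    (h' : p + r = N) (X : L) (α : L [⋀^Fin (p + 1)]→ₗ[A] A) (β : L [⋀^Fin r]→ₗ[A] A) :
    (∑ i, (-1 : ℤ) ^ (blockEquiv h (.inl i) : ℕ) • (tensor h (α : MultilinearMap A _ A)
      β).curryMid (blockEquiv h (.inl i)) X).alternatization =
      ((p + 1).factorial * r.factorial) • wedge h' (interior X α) β := by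
  simp only [curryMid_tensor_inl h h', val_blockEquiv_inl, smul_smul, ← mul_pow, neg_mul_neg,
    one_mul, one_pow, one_smul, Finset.sum_const, Finset.card_univ, Fintype.card_fin, map_nsmul,
    Nat.factorial_succ, mul_assoc]
  rw [mul_smul, factorial_smul_wedge]
  rfl

theorem alternatization_sum_curryMid_tensor_inr {p r N : ℕ} (h : p + (r + 1) = N + 1)
    (h' : p + r = N) (X : L) (α : L [⋀^Fin p]→ₗ[A] A) (β : L [⋀^Fin (r + 1)]→ₗ[A] A) :
    (∑ i, (-1 : ℤ) ^ (blockEquiv h (.inr i) : ℕ) • (tensor h (α : MultilinearMap A _ A)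
      β).curryMid (blockEquiv h (.inr i)) X).alternatization =
      (p.factorial * (r + 1).factorial) • (-1 : ℝ) ^ p • wedge h' α (interior X β) := by
  have sign (i : Fin (r + 1)) : (-1 : ℤ) ^ (p + i : ℕ) * (-1) ^ (i : ℕ) = (-1) ^ p := by
    rw [pow_add, mul_assoc, ← mul_pow, neg_mul_neg, one_mul, one_pow, mul_one]
  simp only [curryMid_tensor_inr h h', val_blockEquiv_inr, smul_smul, sign, Finset.sum_const,
    Finset.card_univ, Fintype.card_fin, map_nsmul, map_zsmul]
  have smul_wedge : (p.factorial * (r + 1).factorial) • (-1 : ℝ) ^ p • wedge h' α (interior X β) =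
      (r + 1) • (-1 : ℤ) ^ p • (p.factorial * r.factorial) • wedge h' α (interior X β) := by
    rw [Nat.factorial_succ]
    module
  rw [smul_wedge, factorial_smul_wedge]
  rfl

theorem interior_wedge_succ_zero {p N : ℕ} (h : p + 1 + 0 = N + 1) (h' : p + 0 = N) (X : L)
    (α : L [⋀^Fin (p + 1)]→ₗ[A] A) (β : L [⋀^Fin 0]→ₗ[A] A) :
    interior X (wedge h α β) = wedge h' (interior X α) β := by
  refine eq_of_nsmul_eq_nsmul (mul_ne_zero (p + 1).factorial_ne_zero (Nat.factorial_ne_zero 0)) ?_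
  rw [factorial_smul_interior_wedge, Fintype.sum_sum_type, Fin.sum_univ_zero, add_zero,
    alternatization_sum_curryMid_tensor_inl]

theorem interior_wedge_zero_succ {r N : ℕ} (h : 0 + (r + 1) = N + 1) (h' : 0 + r = N) (X : L)
    (α : L [⋀^Fin 0]→ₗ[A] A) (β : L [⋀^Fin (r + 1)]→ₗ[A] A) :
    interior X (wedge h α β) = wedge h' α (interior X β) := by
  refine eq_of_nsmul_eq_nsmul (mul_ne_zero (Nat.factorial_ne_zero 0) (r + 1).factorial_ne_zero) ?_
  rw [factorial_smul_interior_wedge, Fintype.sum_sum_type, Fin.sum_univ_zero, zero_add,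
    alternatization_sum_curryMid_tensor_inr _ h', pow_zero, one_smul]

theorem interior_wedge_succ_succ {p r N : ℕ} (h : p + 1 + (r + 1) = N + 1) (X : L)
    (h₁ : p + (r + 1) = N) (h₂ : p + 1 + r = N)
    (α : L [⋀^Fin (p + 1)]→ₗ[A] A) (β : L [⋀^Fin (r + 1)]→ₗ[A] A) :
    interior X (wedge h α β) =
      wedge h₁ (interior X α) β + (-1 : ℝ) ^ (p + 1) • wedge h₂ α (interior X β) := by
  refine eq_of_nsmul_eq_nsmul
    (mul_ne_zero (p + 1).factorial_ne_zero (r + 1).factorial_ne_zero) ?_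
  rw [factorial_smul_interior_wedge, Fintype.sum_sum_type, map_add,
    alternatization_sum_curryMid_tensor_inl, alternatization_sum_curryMid_tensor_inr, smul_add]

variable [Module ℝ L] [IsScalarTower ℝ A L]
  (ρ : L →ₗ[A] Derivation ℝ A A) (br : L →ₗ[ℝ] L →ₗ[ℝ] L) (hbr : ∀ X, br X X = 0)
  (hleib : ∀ (X Y : L) (f : A), br X (f • Y) = f • br X Y + ρ X f • Y)

local notation "𝐃" => koszul ρ br hbr hleib
local notation "𝓛" => lieDer ρ br hbr hleib

theorem lieDer_wedge {p r N : ℕ} (h : p + r = N) (X : L) (α : L [⋀^Fin p]→ₗ[A] A)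
    (β : L [⋀^Fin r]→ₗ[A] A) :
    𝓛 X N (wedge h α β) = wedge h (𝓛 X p α) β + wedge h α (𝓛 X r β) := by
  induction N generalizing p r with
  | zero =>
    obtain ⟨rfl, rfl⟩ := Nat.add_eq_zero_iff.1 h
    ext v
    simp [lieDer_apply, wedge_apply_of_isEmpty, Derivation.leibniz, mul_comm, add_comm]
  | succ N ih =>
    refine ext_interior fun Z => ?_
    rcases p with _ | p <;> rcases r with _ | r
    · omega
    · have h' : 0 + r = N := by omega
      simp only [interior_lieDer, map_add, interior_wedge_zero_succ _ h', ih h', map_sub]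
      abel
    · have h' : p + 0 = N := by omega
      simp only [interior_lieDer, map_add, interior_wedge_succ_zero _ h', ih h', map_sub,
        LinearMap.sub_apply]
      abel
    · have h₁ : p + (r + 1) = N := by omega
      have h₂ : p + 1 + r = N := by omega
      simp only [interior_lieDer, map_add, interior_wedge_succ_succ _ _ h₁ h₂, ih h₁, ih h₂,
        map_sub, LinearMap.sub_apply, map_smul]
      module

theorem koszul_wedge {p r N : ℕ} (h : p + r = N) (h₁ : p + 1 + r = N + 1)
    (h₂ : p + (r + 1) = N + 1) (α : L [⋀^Fin p]→ₗ[A] A) (β : L [⋀^Fin r]→ₗ[A] A) :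
    𝐃 N (wedge h α β) = wedge h₁ (𝐃 p α) β + (-1 : ℝ) ^ p • wedge h₂ α (𝐃 r β) := by
  induction N generalizing p r with
  | zero =>
    obtain ⟨rfl, rfl⟩ := Nat.add_eq_zero_iff.1 h
    refine ext_interior fun X => ?_
    rw [interior_koszul_zero, map_add, map_smul, interior_wedge_succ_zero h₁ h,
      interior_wedge_zero_succ h₂ h, lieDer_wedge, interior_koszul_zero, interior_koszul_zero,
      pow_zero, one_smul]
  | succ N ih =>
    refine ext_interior fun X => ?_
    rw [interior_koszul_succ, map_add, map_smul, lieDer_wedge]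
    rcases p with _ | p <;> rcases r with _ | r
    · omega
    · have h' : 0 + r = N := by omega
      have h₃ : 0 + 1 + r = N + 1 := by omega
      rw [interior_wedge_zero_succ h h', ih h' h₃ h, interior_wedge_succ_succ h₁ X h h₃,
        interior_wedge_zero_succ h₂ h]
      simp only [interior_koszul_zero, interior_koszul_succ, map_sub]
      module
    · have h' : p + 0 = N := by omega
      have h₃ : p + (0 + 1) = N + 1 := by omega
      rw [interior_wedge_succ_zero h h', ih h' h h₃, interior_wedge_succ_zero h₁ h,
        interior_wedge_succ_succ h₂ X h₃ h]
      simp only [interior_koszul_zero, interior_koszul_succ, map_sub, LinearMap.sub_apply,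
        pow_succ]
      rcases neg_one_pow_eq_or ℝ p with sign | sign <;> simp only [sign] <;> module
    · have h₃ : p + (r + 1) = N := by omega
      have h₄ : p + 1 + r = N := by omega
      have h₅ : p + (r + 1 + 1) = N + 1 := by omega
      have h₆ : p + 1 + 1 + r = N + 1 := by omega
      rw [interior_wedge_succ_succ h X h₃ h₄, map_add, map_smul, ih h₃ h h₅, ih h₄ h₆ h,
        interior_wedge_succ_succ h₁ X h h₆, interior_wedge_succ_succ h₂ X h₅ h]
      simp only [interior_koszul_succ, map_sub, LinearMap.sub_apply, pow_succ]
      rcases neg_one_pow_eq_or ℝ p with sign | sign <;> simp only [sign] <;> module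

end Wedge

section Morphism

variable {A L L' : Type*} [CommRing A] [Algebra ℝ A]
  [AddCommGroup L] [Module A L] [Module ℝ L] [IsScalarTower ℝ A L]
  [AddCommGroup L'] [Module A L'] [Module ℝ L'] [IsScalarTower ℝ A L']
  (ρ : L →ₗ[A] Derivation ℝ A A) (br : L →ₗ[ℝ] L →ₗ[ℝ] L) (hbr : ∀ X, br X X = 0)
  (hleib : ∀ (X Y : L) (f : A), br X (f • Y) = f • br X Y + ρ X f • Y)
  (ρ' : L' →ₗ[A] Derivation ℝ A A) (br' : L' →ₗ[ℝ] L' →ₗ[ℝ] L') (hbr' : ∀ X, br' X X = 0)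
  (hleib' : ∀ (X Y : L') (f : A), br' X (f • Y) = f • br' X Y + ρ' X f • Y)

theorem koszul_compLinearMap (φ : L →ₗ[A] L') (hρ : ∀ X, ρ' (φ X) = ρ X)
    (hφ : ∀ X Y, φ (br X Y) = br' (φ X) (φ Y)) {p : ℕ} (θ : L' [⋀^Fin p]→ₗ[A] A) :
    koszul ρ br hbr hleib p (θ.compLinearMap φ) =
      (koszul ρ' br' hbr' hleib' p θ).compLinearMap φ := by
  ext v
  cases p with
  | zero => simp [koszulFun, hρ, Subsingleton.elim (fun _ : Fin 0 => φ _) ![]]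
  | succ p =>
    have comp_vecCons (X : L) (w : Fin p → L) :
        (fun l => φ (Matrix.vecCons X w l)) = Matrix.vecCons (φ X) fun l => φ (w l) := by
      funext l
      cases l using Fin.cases <;> rfl
    simp only [koszul_apply, koszulFun, AlternatingMap.compLinearMap_apply, comp_vecCons,
      hφ, hρ, Fin.removeNth_apply]
    rfl

end Morphism

section Degree

variable {A L : Type*} [CommRing A] [AddCommGroup L] [Module A L] (V H : Submodule A L)

/-- The forms all of whose components have degree in `[l, u]` along `V`, for complementary
submodules `V` and `H`: they vanish on arguments from `V` and `H` unless the number of those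
taken from `V` lies in `[l, u]`. -/
def formsOfDegree (l u : ℤ) (p : ℕ) : Submodule A (L [⋀^Fin p]→ₗ[A] A) where
  carrier := {θ | ∀ (v : Fin p → L) (T : Finset (Fin p)), (∀ i ∈ T, v i ∈ V) →
    (∀ i ∉ T, v i ∈ H) → (T.card : ℤ) ∉ Set.Icc l u → θ v = 0}
  add_mem' hθ hη v T hV hH hT := by simp [hθ v T hV hH hT, hη v T hV hH hT]
  zero_mem' _ _ _ _ _ := rfl
  smul_mem' f θ hθ v T hV hH hT := by simp [hθ v T hV hH hT]

variable {V H} {l u l' u' k k' : ℤ} {p q : ℕ}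

theorem formsOfDegree_mono (hl : l' ≤ l) (hu : u ≤ u') :
    formsOfDegree V H l u p ≤ formsOfDegree V H l' u' p :=
  fun _ hθ v T hV hH hT => hθ v T hV hH fun h => hT (Set.Icc_subset_Icc hl hu h)

theorem mem_formsOfDegree_zero {θ : L [⋀^Fin 0]→ₗ[A] A} :
    θ ∈ formsOfDegree V H l u 0 ↔ (0 ∉ Set.Icc l u → θ = 0) := by
  refine ⟨fun hθ h0 => AlternatingMap.ext fun v => hθ v ∅ (by simp) (by simp) (by simpa using h0),
    fun hθ v T _ _ hT => ?_⟩
  rw [Subsingleton.elim T ∅] at hT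
  simp [hθ (by simpa using hT)]

variable [Algebra ℝ A]

theorem mem_formsOfDegree_succ {θ : L [⋀^Fin (p + 1)]→ₗ[A] A} :
    θ ∈ formsOfDegree V H l u (p + 1) ↔
      (∀ X ∈ V, interior X θ ∈ formsOfDegree V H (l - 1) (u - 1) p) ∧
        ∀ X ∈ H, interior X θ ∈ formsOfDegree V H l u p := by
  refine ⟨fun hθ => ⟨fun X hX v T hV hH hT => ?_, fun X hX v T hV hH hT => ?_⟩, ?_⟩
  · refine hθ (Matrix.vecCons X v) (insert 0 (T.map (Fin.succEmb p))) ?_ ?_ ?_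
    · simpa [hX] using hV
    · simpa [Fin.forall_fin_succ] using hH
    · rw [Finset.card_insert_of_notMem (by simp), Finset.card_map]
      simp only [Set.mem_Icc, Nat.cast_add, Nat.cast_one] at hT ⊢
      omega
  · refine hθ (Matrix.vecCons X v) (T.map (Fin.succEmb p)) ?_ ?_ (by rwa [Finset.card_map])
    · simpa using hV
    · simpa [Fin.forall_fin_succ, hX] using hH
  · rintro ⟨hθV, hθH⟩ v T hV hH hT
    have card_eq : T.card = if 0 ∈ T then ({i | i.succ ∈ T} : Finset (Fin p)).card + 1
        else ({i | i.succ ∈ T} : Finset (Fin p)).card := by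
      rw [← Fin.card_filter_univ_succ (· ∈ T), Finset.filter_univ_mem]
    have tail_V : ∀ i ∈ ({i | i.succ ∈ T} : Finset (Fin p)), v i.succ ∈ V :=
      fun i hi => hV i.succ (by simpa using hi)
    have tail_H : ∀ i ∉ ({i | i.succ ∈ T} : Finset (Fin p)), v i.succ ∈ H :=
      fun i hi => hH i.succ (by simpa using hi)
    rw [← Matrix.cons_head_tail v, ← interior_apply]
    by_cases h0 : 0 ∈ T
    · refine hθV _ (hV 0 h0) _ _ tail_V tail_H ?_
      rw [card_eq, if_pos h0] at hT
      simp only [Set.mem_Icc, Nat.cast_add, Nat.cast_one] at hT ⊢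
      omega
    · refine hθH _ (hH 0 h0) _ _ tail_V tail_H ?_
      rwa [card_eq, if_neg h0] at hT

variable (V H) in
/-- An operator on forms shifts the degree along `V` by amounts in `[k, l]` only. -/
def HasDegreeShift (k l : ℤ) (T : (L [⋀^Fin p]→ₗ[A] A) →ₗ[ℝ] (L [⋀^Fin q]→ₗ[A] A)) : Prop :=
  ∀ (b : ℤ), ∀ θ ∈ formsOfDegree V H b b p, T θ ∈ formsOfDegree V H (b + k) (b + l) q

theorem HasDegreeShift.mono {T : (L [⋀^Fin p]→ₗ[A] A) →ₗ[ℝ] (L [⋀^Fin q]→ₗ[A] A)}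
    (hT : HasDegreeShift V H k l T) (hk : k' ≤ k) (hl : l ≤ l') : HasDegreeShift V H k' l' T :=
  fun b θ hθ => formsOfDegree_mono (by lia) (by lia) (hT b θ hθ)

theorem hasDegreeShift_interior_left {X : L} (hX : X ∈ V) :
    HasDegreeShift V H (-1) (-1) (interior X (A := A) (p := p)) :=
  fun _ _ hθ => (mem_formsOfDegree_succ.1 hθ).1 X hX

theorem hasDegreeShift_interior_right {X : L} (hX : X ∈ H) :
    HasDegreeShift V H 0 0 (interior X (A := A) (p := p)) := fun b θ hθ => by
  simpa using (mem_formsOfDegree_succ.1 hθ).2 X hX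

theorem hasDegreeShift_interior (hVH : V ⊔ H = ⊤) (X : L) :
    HasDegreeShift V H (-1) 0 (interior X (A := A) (p := p)) := fun b θ hθ => by
  obtain ⟨Y, hY, Z, hZ, rfl⟩ := Submodule.mem_sup.1 (hVH ▸ Submodule.mem_top : X ∈ V ⊔ H)
  rw [interior_add]
  exact add_mem ((hasDegreeShift_interior_left hY).mono le_rfl (by simp) b θ hθ)
    ((hasDegreeShift_interior_right hZ).mono (by simp) le_rfl b θ hθ)

theorem hasDegreeShift_zero_degree (T : (L [⋀^Fin 0]→ₗ[A] A) →ₗ[ℝ] (L [⋀^Fin 0]→ₗ[A] A)) :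
    HasDegreeShift V H 0 0 T := fun b θ hθ => by
  rw [add_zero, mem_formsOfDegree_zero] at *
  exact fun hb => by rw [hθ hb, map_zero]

theorem hasDegreeShift_of_interior_eq (T : ∀ p, (L [⋀^Fin p]→ₗ[A] A) →ₗ[ℝ] (L [⋀^Fin p]→ₗ[A] A))
    (τ : L → L)
    (hT : ∀ Z p θ, interior Z (T (p + 1) θ) = T p (interior Z θ) - interior (τ Z) θ)
    (h0 : HasDegreeShift V H k l (T 0))
    (hV : ∀ Z ∈ V, ∀ p, HasDegreeShift V H (k - 1) (l - 1) (interior (τ Z) (A := A) (p := p)))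
    (hH : ∀ Z ∈ H, ∀ p, HasDegreeShift V H k l (interior (τ Z) (A := A) (p := p))) (p : ℕ) :
    HasDegreeShift V H k l (T p) := by
  induction p with
  | zero => exact h0
  | succ p ih =>
    intro b θ hθ
    obtain ⟨hθV, hθH⟩ := mem_formsOfDegree_succ.1 hθ
    refine mem_formsOfDegree_succ.2 ⟨fun Z hZ => ?_, fun Z hZ => ?_⟩ <;> rw [hT]
    · refine sub_mem ?_ ?_
      · convert ih (b - 1) _ (hθV Z hZ) using 2 <;> ring
      · convert hV Z hZ p b θ hθ using 2 <;> ring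
    · exact sub_mem (ih b _ (hθH Z hZ)) (hH Z hZ p b θ hθ)

theorem hasDegreeShift_of_interior_eq_sub
    (T : ∀ p, (L [⋀^Fin p]→ₗ[A] A) →ₗ[ℝ] (L [⋀^Fin (p + 1)]→ₗ[A] A))
    (N : L → ∀ p, (L [⋀^Fin p]→ₗ[A] A) →ₗ[ℝ] (L [⋀^Fin p]→ₗ[A] A))
    (hT0 : ∀ Z θ, interior Z (T 0 θ) = N Z 0 θ)
    (hT : ∀ Z p θ, interior Z (T (p + 1) θ) = N Z (p + 1) θ - T p (interior Z θ))
    (hV : ∀ Z ∈ V, ∀ p, HasDegreeShift V H (k - 1) (l - 1) (N Z p))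
    (hH : ∀ Z ∈ H, ∀ p, HasDegreeShift V H k l (N Z p)) (p : ℕ) :
    HasDegreeShift V H k l (T p) := by
  induction p with
  | zero =>
    refine fun b θ hθ => mem_formsOfDegree_succ.2 ⟨fun Z hZ => ?_, fun Z hZ => ?_⟩ <;> rw [hT0]
    · convert hV Z hZ 0 b θ hθ using 2 <;> ring
    · exact hH Z hZ 0 b θ hθ
  | succ p ih =>
    intro b θ hθ
    obtain ⟨hθV, hθH⟩ := mem_formsOfDegree_succ.1 hθ
    refine mem_formsOfDegree_succ.2 ⟨fun Z hZ => ?_, fun Z hZ => ?_⟩ <;> rw [hT]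
    · refine sub_mem ?_ ?_
      · convert hV Z hZ _ b θ hθ using 2 <;> ring
      · convert ih (b - 1) _ (hθV Z hZ) using 2 <;> ring
    · exact sub_mem (hH Z hZ _ b θ hθ) (ih b _ (hθH Z hZ))

end Degree

variable {n : ℕ} {M : Type*} [TopologicalSpace M] [ChartedSpace (EuclideanSpace ℝ (Fin n)) M]
  [IsManifold (𝓡 n) ∞ M]

section Algebroid

theorem dirDeriv_lieBr_smul (X Y Z : VF n M) (f : Fun n M) :
    dirDeriv (lieBr X Y) f • Z = (dirDeriv X (dirDeriv Y f) - dirDeriv Y (dirDeriv X f)) • Z := by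
  have h := lieBr_jacobi X Y (f • Z)
  simp only [lieBr_leibniz, map_add, smul_add, lieBr_jacobi X Y Z] at h
  rw [sub_smul, ← sub_eq_zero]
  rw [← sub_eq_zero, ← neg_eq_zero] at h
  rw [← h]
  abel

-- The two sides agree after multiplication by any vector field. At a point where all vector
-- fields vanish, both sides vanish too.
theorem dirDeriv_lieBr (X Y : VF n M) (f : Fun n M) :
    dirDeriv (lieBr X Y) f = dirDeriv X (dirDeriv Y f) - dirDeriv Y (dirDeriv X f) := by
  ext x
  by_cases hZ : ∀ Z : VF n M, Z x = 0
  · have h0 (Z : VF n M) (g : Fun n M) : dirDeriv Z g x = 0 := by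
      rw [dirDeriv_apply, hZ Z]
      exact map_zero _
    change _ = dirDeriv X (dirDeriv Y f) x - dirDeriv Y (dirDeriv X f) x
    rw [h0, h0, h0, sub_zero]
  · obtain ⟨Z, hZ⟩ := not_forall.1 hZ
    have h := congrArg (fun W : VF n M => W x) (dirDeriv_lieBr_smul X Y Z f)
    exact smul_left_injective ℝ hZ h

variable {L : Type*} [AddCommGroup L] [Module (Fun n M) L] [Module ℝ L]
  [IsScalarTower ℝ (Fun n M) L] (𝓐 : LieAlgebroid n M L)

theorem LieAlgebroid.isAssociatedOperator_differential :
    𝓐.IsAssociatedOperator 𝓐.differential where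
  on_functions f X := rfl
  on_one_forms α X Y := by
    have update_eq : Function.update ![Y] 0 (𝓐.bracket X Y) = ![𝓐.bracket X Y] := by
      rw [Function.update_eq_const_of_subsingleton]
      exact Matrix.const_fin1_eq _
    rw [differential_apply]
    refine (koszulFun_vecCons (dirDeriv ∘ₗ 𝓐.anchor) 𝓐.bracket α X ![Y]).trans ?_
    rw [Fin.sum_univ_one, sub_right_comm]
    exact congrArg (_ - α ·) update_eq
  derivation p r α β := koszul_wedge (dirDeriv ∘ₗ 𝓐.anchor) 𝓐.bracket 𝓐.bracket_self
    𝓐.leibniz rfl (by omega) rfl α β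

theorem LieAlgebroid.differential_differential
    (h : ∀ X Y, 𝓐.anchor (𝓐.bracket X Y) = lieBr (𝓐.anchor X) (𝓐.anchor Y)) (p : ℕ)
    (θ : Form n M L p) : 𝓐.differential (p + 1) (𝓐.differential p θ) = 0 :=
  koszul_koszul _ _ _ _ 𝓐.jacobi (fun X Y f => by
    simp only [LinearMap.comp_apply, h, dirDeriv_lieBr]) θ

/-- The Lie derivative `L_X` on the forms of a Lie algebroid. -/
abbrev LieAlgebroid.lieDerivative (X : L) (p : ℕ) : Form n M L p →ₗ[ℝ] Form n M L p :=
  lieDer (dirDeriv ∘ₗ 𝓐.anchor) 𝓐.bracket 𝓐.bracket_self 𝓐.leibniz X p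

theorem LieAlgebroid.interior_differential_zero (X : L) (θ : Form n M L 0) :
    interior X (𝓐.differential 0 θ) = 𝓐.lieDerivative X 0 θ := rfl

theorem LieAlgebroid.interior_differential_succ (X : L) (p : ℕ) (θ : Form n M L (p + 1)) :
    interior X (𝓐.differential (p + 1) θ) =
      𝓐.lieDerivative X (p + 1) θ - 𝓐.differential p (interior X θ) :=
  interior_koszul_succ _ _ _ _ X θ

theorem LieAlgebroid.interior_lieDerivative (X Z : L) (p : ℕ) (θ : Form n M L (p + 1)) :
    interior Z (𝓐.lieDerivative X (p + 1) θ) =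
      𝓐.lieDerivative X p (interior Z θ) - interior (𝓐.bracket X Z) θ :=
  interior_lieDer _ _ _ _ X Z θ

end Algebroid

namespace EhresmannConnection

variable {F : RegularFoliation n M} (c : EhresmannConnection F)

theorem sub_proj_mem_horizontal (X : VF n M) : X - c.proj X ∈ c.horizontal := by
  rw [horizontal, LinearMap.mem_ker, map_sub, proj_proj, sub_self]

theorem sections_sup_horizontal : F.sections ⊔ c.horizontal = ⊤ :=
  eq_top_iff.2 fun X _ => Submodule.mem_sup.2
    ⟨_, c.proj_mem X, _, c.sub_proj_mem_horizontal X, add_sub_cancel _ _⟩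

variable {c} {X Y : VF n M}

theorem bracket_of_mem_sections (hX : X ∈ F.sections) (hY : Y ∈ F.sections) :
    c.bracket X Y = lieBr X Y := by
  have h := c.proj_lieBr X Y
  rw [c.proj_of_mem hX, c.proj_of_mem hY] at h
  rw [bracket_eq, c.proj_of_mem hX, c.proj_of_mem hY, map_add, h, sub_self, add_zero]

theorem bracket_mem_sections (hX : X ∈ F.sections) (hY : Y ∈ F.sections) :
    c.bracket X Y ∈ F.sections := by
  rw [bracket_of_mem_sections hX hY]
  exact F.lieBr_mem hX hY

theorem bracket_mem_horizontal_of_left (hX : X ∈ c.horizontal) (Y : VF n M) :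
    c.bracket X Y ∈ c.horizontal := by
  rw [horizontal, LinearMap.mem_ker] at *
  rw [proj_bracket, hX, map_zero, LinearMap.zero_apply]

theorem bracket_mem_horizontal_of_right (X : VF n M) (hY : Y ∈ c.horizontal) :
    c.bracket X Y ∈ c.horizontal := by
  rw [horizontal, LinearMap.mem_ker] at *
  rw [proj_bracket, hY, map_zero]

theorem bracket_of_mem_horizontal (hX : X ∈ c.horizontal) (hY : Y ∈ c.horizontal) :
    c.bracket X Y = 0 := by
  rw [horizontal, LinearMap.mem_ker] at *
  simp [bracket_eq, hX, hY]

theorem lieBr_sub_bracket_mem_sections (hX : X ∈ F.sections) (hY : Y ∈ c.horizontal) :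
    lieBr X Y - c.bracket X Y ∈ F.sections := by
  rw [horizontal, LinearMap.mem_ker] at hY
  simpa [bracket_eq, c.proj_of_mem hX, hY] using c.proj_mem _

theorem lieBr_sub_bracket_mem_sections' (hX : X ∈ c.horizontal) (hY : Y ∈ F.sections) :
    lieBr X Y - c.bracket X Y ∈ F.sections := by
  rw [lieBr_swap Y X, c.bracket_swap Y X, ← neg_sub', neg_mem_iff]
  exact lieBr_sub_bracket_mem_sections hY hX

variable (c) in
/-- The forms all of whose components of type `(a, b)` have `b ∈ [l, u]`. -/
abbrev formsOfFibreDegree (l u : ℤ) (p : ℕ) : Submodule (Fun n M) (Form n M (VF n M) p) :=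
  formsOfDegree F.sections c.horizontal l u p

variable (c) in
/-- Every component of `T` which maps forms of type `(a, b)` to forms of type `(a', b')` has
`b' - b ∈ [k, l]`. -/
abbrev ShiftsFibreDegree (k l : ℤ) {p q : ℕ}
    (T : Form n M (VF n M) p →ₗ[ℝ] Form n M (VF n M) q) : Prop :=
  HasDegreeShift F.sections c.horizontal k l T

theorem shiftsFibreDegree_lieDerivative_of_mem_sections (hX : X ∈ F.sections) (p : ℕ) :
    c.ShiftsFibreDegree 0 0 (c.algebroid.lieDerivative X p) :=
  hasDegreeShift_of_interior_eq _ (c.bracket X) (c.algebroid.interior_lieDerivative X)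
    (hasDegreeShift_zero_degree _)
    (fun _ hZ _ => hasDegreeShift_interior_left (bracket_mem_sections hX hZ))
    (fun _ hZ _ => hasDegreeShift_interior_right (bracket_mem_horizontal_of_right X hZ)) p

theorem shiftsFibreDegree_lieDerivative_of_mem_horizontal (hX : X ∈ c.horizontal) (p : ℕ) :
    c.ShiftsFibreDegree 1 1 (c.algebroid.lieDerivative X p) := by
  refine hasDegreeShift_of_interior_eq _ (c.bracket X) (c.algebroid.interior_lieDerivative X)
    (fun b θ _ => ?_)
    (fun Z _ _ => (hasDegreeShift_interior_right (bracket_mem_horizontal_of_left hX Z)).mono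
      (by simp) (by simp))
    (fun Z hZ _ b θ _ => ?_) p
  · have lieDerivative_zero : c.algebroid.lieDerivative X 0 θ = 0 := by
      ext v : 1
      have anchor_zero : c.algebroid.anchor X = 0 := hX
      simp [lieDer_apply, anchor_zero]
    exact lieDerivative_zero ▸ zero_mem _
  · rw [bracket_of_mem_horizontal hX hZ, interior_zero]
    exact zero_mem _

variable (c) in
theorem shiftsFibreDegree_differential (p : ℕ) :
    c.ShiftsFibreDegree 1 1 (c.algebroid.differential p) :=
  hasDegreeShift_of_interior_eq_sub _ c.algebroid.lieDerivative
    c.algebroid.interior_differential_zero c.algebroid.interior_differential_succ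
    (fun _ hZ p => (shiftsFibreDegree_lieDerivative_of_mem_sections hZ p).mono
      (by simp) (by simp))
    (fun _ hZ => shiftsFibreDegree_lieDerivative_of_mem_horizontal hZ) p

theorem interior_lieDerivative_sub (X Z : VF n M) (p : ℕ) (θ : Form n M (VF n M) (p + 1)) :
    interior Z (((tangentAlgebroid n M).lieDerivative X (p + 1) -
        c.algebroid.lieDerivative X (p + 1)) θ) =
      ((tangentAlgebroid n M).lieDerivative X p - c.algebroid.lieDerivative X p) (interior Z θ) -
        interior (lieBr X Z - c.bracket X Z) θ := by
  simp only [LinearMap.sub_apply, map_sub, LieAlgebroid.interior_lieDerivative, interior_sub]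
  exact sub_sub_sub_comm _ _ _ _

theorem shiftsFibreDegree_lieDerivative_sub_of_mem_sections (hX : X ∈ F.sections) (p : ℕ) :
    c.ShiftsFibreDegree (-1) (-1)
      ((tangentAlgebroid n M).lieDerivative X p - c.algebroid.lieDerivative X p) := by
  refine hasDegreeShift_of_interior_eq
    (fun p => (tangentAlgebroid n M).lieDerivative X p - c.algebroid.lieDerivative X p) _
    (interior_lieDerivative_sub X) (fun b θ _ => ?_) (fun Z hZ _ b θ _ => ?_)
    (fun Z hZ _ => hasDegreeShift_interior_left (lieBr_sub_bracket_mem_sections hX hZ)) p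
  · have lieDerivative_eq :
        (tangentAlgebroid n M).lieDerivative X 0 θ = c.algebroid.lieDerivative X 0 θ := by
      ext v : 1
      have anchor_eq : c.algebroid.anchor X = (tangentAlgebroid n M).anchor X := c.proj_of_mem hX
      simp [lieDer_apply, anchor_eq]
    rw [LinearMap.sub_apply, lieDerivative_eq, sub_self]
    exact zero_mem _
  · rw [bracket_of_mem_sections hX hZ, sub_self, interior_zero]
    exact zero_mem _

theorem shiftsFibreDegree_lieDerivative_sub_of_mem_horizontal (hX : X ∈ c.horizontal) (p : ℕ) :
    c.ShiftsFibreDegree (-1) 0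
      ((tangentAlgebroid n M).lieDerivative X p - c.algebroid.lieDerivative X p) :=
  hasDegreeShift_of_interior_eq
    (fun p => (tangentAlgebroid n M).lieDerivative X p - c.algebroid.lieDerivative X p) _
    (interior_lieDerivative_sub X)
    ((hasDegreeShift_zero_degree _).mono (by simp) le_rfl)
    (fun _ hZ _ => (hasDegreeShift_interior_left (lieBr_sub_bracket_mem_sections' hX hZ)).mono
      (by simp) (by simp))
    (fun _ _ _ => hasDegreeShift_interior c.sections_sup_horizontal _) p

variable (c) in
theorem shiftsFibreDegree_extD_sub_differential (p : ℕ) :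
    c.ShiftsFibreDegree (-1) 0 (extD n M p - c.algebroid.differential p) := by
  refine hasDegreeShift_of_interior_eq_sub (fun p => extD n M p - c.algebroid.differential p)
    (fun X p => (tangentAlgebroid n M).lieDerivative X p - c.algebroid.lieDerivative X p)
    (fun Z θ => map_sub (interior Z) _ _) (fun Z p θ => ?_)
    (fun _ hZ p => (shiftsFibreDegree_lieDerivative_sub_of_mem_sections hZ p).mono
      (by simp) (by simp))
    (fun _ hZ => shiftsFibreDegree_lieDerivative_sub_of_mem_horizontal hZ) p
  simp only [LinearMap.sub_apply, map_sub, LieAlgebroid.interior_differential_succ]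
  exact sub_sub_sub_comm _ _ _ _

variable (c) {p : ℕ}

theorem sel_mem_sections {S : Finset (Fin p)} {i : Fin p} (hi : i ∈ S) (X : VF n M) :
    c.sel S i X ∈ F.sections := by
  simpa [sel, hi] using c.proj_mem X

theorem sel_mem_horizontal {S : Finset (Fin p)} {i : Fin p} (hi : i ∉ S) (X : VF n M) :
    c.sel S i X ∈ c.horizontal := by
  simpa [sel, hi] using c.sub_proj_mem_horizontal X

theorem sel_of_mem_sections {X : VF n M} (hX : X ∈ F.sections) (S : Finset (Fin p)) (i : Fin p) :
    c.sel S i X = if i ∈ S then X else 0 := by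
  by_cases hi : i ∈ S <;> simp [sel, hi, c.proj_of_mem hX]

theorem sel_of_mem_horizontal {X : VF n M} (hX : X ∈ c.horizontal) (S : Finset (Fin p))
    (i : Fin p) : c.sel S i X = if i ∈ S then 0 else X := by
  rw [horizontal, LinearMap.mem_ker] at hX
  by_cases hi : i ∈ S <;> simp [sel, hi, hX]

theorem eq_sum_sel (θ : Form n M (VF n M) p) (v : Fin p → VF n M) :
    θ v = ∑ S : Finset (Fin p), θ fun i => c.sel S i (v i) := by
  have split : v = (fun i => c.proj (v i)) + fun i => v i - c.proj (v i) :=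
    funext fun i => (add_sub_cancel (c.proj (v i)) (v i)).symm
  conv_lhs => rw [split]
  refine (θ.toMultilinearMap.map_add_univ _ _).trans (Finset.sum_congr rfl fun S _ => ?_)
  refine congrArg θ (funext fun i => ?_)
  by_cases hi : i ∈ S <;> simp [sel, hi]

theorem form_ext {θ η : Form n M (VF n M) p}
    (h : ∀ (v : Fin p → VF n M) (T : Finset (Fin p)), (∀ i ∈ T, v i ∈ F.sections) →
      (∀ i ∉ T, v i ∈ c.horizontal) → θ v = η v) : θ = η := by
  ext v : 1
  rw [c.eq_sum_sel θ, c.eq_sum_sel η]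
  exact Finset.sum_congr rfl fun S _ => h _ S (fun i hi => c.sel_mem_sections hi (v i))
    fun i hi => c.sel_mem_horizontal hi (v i)

variable {c} {v : Fin p → VF n M} {T : Finset (Fin p)}

theorem map_sel (θ : Form n M (VF n M) p) (hV : ∀ i ∈ T, v i ∈ F.sections)
    (hH : ∀ i ∉ T, v i ∈ c.horizontal) (S : Finset (Fin p)) :
    (θ fun i => c.sel S i (v i)) = if S = T then θ v else 0 := by
  have sel_apply (i : Fin p) : c.sel S i (v i) = if i ∈ S ↔ i ∈ T then v i else 0 := by
    by_cases hi : i ∈ T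
    · simp [hi, c.sel_of_mem_sections (hV i hi)]
    · simp [hi, c.sel_of_mem_horizontal (hH i hi)]
  split_ifs with hST
  · subst hST
    simp [sel_apply]
  · obtain ⟨i, hi⟩ : ∃ i, ¬(i ∈ S ↔ i ∈ T) := by
      simpa [Finset.ext_iff] using hST
    exact θ.map_coord_zero i (by rw [sel_apply, if_neg hi])

theorem typePart_apply_of_mem (b : ℤ) (θ : Form n M (VF n M) p)
    (hV : ∀ i ∈ T, v i ∈ F.sections) (hH : ∀ i ∉ T, v i ∈ c.horizontal) :
    c.typePart b θ v = if (T.card : ℤ) = b then θ v else 0 := by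
  simp only [typePart_apply, map_sel θ hV hH, Finset.sum_ite_eq', Finset.mem_filter,
    Finset.mem_univ, true_and]


theorem typePart_mem (b : ℤ) (θ : Form n M (VF n M) p) :
    c.typePart b θ ∈ c.formsOfFibreDegree b b p := fun v T hV hH hT => by
  rw [typePart_apply_of_mem b θ hV hH, if_neg fun h => hT ⟨h.ge, h.le⟩]

theorem mem_formsOfFibreDegree (θ : Form n M (VF n M) p) :
    θ ∈ c.formsOfFibreDegree 0 p p := fun v T _ _ hT =>
  absurd ⟨by positivity, by exact_mod_cast card_finset_fin_le T⟩ hT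

variable {θ : Form n M (VF n M) p} {l u a b : ℤ}

theorem sum_typePart (hθ : θ ∈ c.formsOfFibreDegree l u p) (s : Finset ℤ)
    (hs : ∀ k ∈ Set.Icc l u, k ∈ s) : ∑ k ∈ s, c.typePart k θ = θ := by
  refine c.form_ext fun v T hV hH => ?_
  have sum_apply : (∑ k ∈ s, c.typePart k θ) v = ∑ k ∈ s, c.typePart k θ v :=
    map_sum (AddMonoidHom.mk' (fun η : Form n M (VF n M) p => η v) fun _ _ => rfl) _ _
  simp only [sum_apply, typePart_apply_of_mem _ θ hV hH, Finset.sum_ite_eq]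
  exact ite_eq_left_iff.2 fun hT => (hθ v T hV hH fun h => hT (hs _ h)).symm

theorem typePart_of_mem (hθ : θ ∈ c.formsOfFibreDegree b b p) : c.typePart b θ = θ := by
  simpa using sum_typePart hθ {b} (by simp)

theorem typePart_of_notMem (hθ : θ ∈ c.formsOfFibreDegree l u p) (hb : b ∉ Set.Icc l u) :
    c.typePart b θ = 0 := by
  refine c.form_ext fun v T hV hH => ?_
  rw [typePart_apply_of_mem b θ hV hH]
  split_ifs with hT
  · exact hθ v T hV hH (hT ▸ hb)
  · rfl

variable (c) in
theorem linearMap_ext {q : ℕ} {T T' : Form n M (VF n M) p →ₗ[ℝ] Form n M (VF n M) q}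
    (h : ∀ b, ∀ θ ∈ c.formsOfFibreDegree b b p, T θ = T' θ) : T = T' := by
  ext1 θ
  rw [← sum_typePart (mem_formsOfFibreDegree (c := c) θ) (Finset.Icc 0 p) (by simp), map_sum,
    map_sum]
  exact Finset.sum_congr rfl fun b _ => h b _ (typePart_mem b θ)

theorem dComponent_of_mem (hθ : θ ∈ c.formsOfFibreDegree b b p) (j : ℤ) :
    c.dComponent j p θ = c.typePart (b + j) (extD n M p θ) := by
  have other_parts (k : ℕ) (hk : (k : ℤ) ≠ b) :
      (c.typePartL (k + j) (p + 1) ∘ₗ extD n M p ∘ₗ c.typePartL k p) θ = 0 := by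
    have typePart_eq : c.typePartL k p θ = 0 := typePart_of_notMem hθ (by simp; omega)
    simp [typePart_eq]
  rw [dComponent, LinearMap.sum_apply]
  by_cases hb : b ∈ Set.Icc (0 : ℤ) p
  · lift b to ℕ using hb.1
    rw [Finset.sum_eq_single_of_mem b (by simpa [Nat.lt_succ_iff] using hb)
      fun k _ hk => other_parts k (by simpa using hk)]
    exact congrArg (fun η => c.typePart (b + j) (extD n M p η)) (typePart_of_mem hθ)
  · have θ_zero : θ = 0 := by
      rw [← typePart_of_mem hθ, typePart_of_notMem (mem_formsOfFibreDegree θ) hb]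
    rw [θ_zero, map_zero]
    simp only [map_zero, Finset.sum_const_zero]
    exact (map_zero (c.typePartL (b + j) (p + 1))).symm

theorem differential_mem (hθ : θ ∈ c.formsOfFibreDegree b b p) :
    c.algebroid.differential p θ ∈ c.formsOfFibreDegree (b + 1) (b + 1) (p + 1) :=
  c.shiftsFibreDegree_differential p b θ hθ

theorem extD_sub_differential_mem (hθ : θ ∈ c.formsOfFibreDegree b b p) :
    extD n M p θ - c.algebroid.differential p θ ∈ c.formsOfFibreDegree (b - 1) b (p + 1) := by
  simpa [sub_eq_add_neg] using c.shiftsFibreDegree_extD_sub_differential p b θ hθ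

variable (c) in
theorem differential_eq_d01 (p : ℕ) : c.algebroid.differential p = c.d01 p := by
  refine c.linearMap_ext fun b θ hθ => ?_
  have typePart_sub : c.typePart (b + 1) (extD n M p θ - c.algebroid.differential p θ) = 0 :=
    typePart_of_notMem (extD_sub_differential_mem hθ) (by simp)
  calc
    c.algebroid.differential p θ = c.typePart (b + 1) (c.algebroid.differential p θ) :=
      (typePart_of_mem (differential_mem hθ)).symm
    _ = c.typePart (b + 1) (extD n M p θ) :=
      (sub_eq_zero.1 ((map_sub (c.typePartL (b + 1) (p + 1)) _ _).symm.trans typePart_sub)).symm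
    _ = c.d01 p θ := (dComponent_of_mem hθ 1).symm

variable (c) in
theorem extD_eq_add (p : ℕ) : extD n M p = c.d10 p + c.d2m1 p + c.d01 p := by
  refine c.linearMap_ext fun b θ hθ => ?_
  have extD_mem : extD n M p θ ∈ c.formsOfFibreDegree (b - 1) (b + 1) (p + 1) := by
    rw [← sub_add_cancel (extD n M p θ) (c.algebroid.differential p θ)]
    exact add_mem (formsOfDegree_mono le_rfl (by simp) (extD_sub_differential_mem hθ))
      (formsOfDegree_mono (by lia) le_rfl (differential_mem hθ))
  have extD_eq := sum_typePart extD_mem {b + 0, b + -1, b + 1} fun k hk => by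
    simp only [Set.mem_Icc, Finset.mem_insert, Finset.mem_singleton] at hk ⊢
    omega
  rw [Finset.sum_insert (by simp), Finset.sum_pair (by simp), ← add_assoc] at extD_eq
  rw [LinearMap.add_apply, LinearMap.add_apply, dComponent_of_mem hθ, dComponent_of_mem hθ,
    dComponent_of_mem hθ, extD_eq]

theorem isOfType_iff :
    c.IsOfType a b θ ↔ a + b = p ∧ θ ∈ c.formsOfFibreDegree b b p := by
  refine and_congr_right fun hab => ⟨fun h v T hV hH hT => ?_, fun h v S => ?_⟩
  · have card_compl := T.card_compl_add_card
    rw [Fintype.card_fin] at card_compl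
    rcases lt_or_ge b T.card with hb | hb
    · exact (h v T).1 hV hb
    · refine (h v Tᶜ).2 (fun i hi => hH i (Finset.mem_compl.1 hi)) ?_
      simp only [Set.mem_Icc] at hT
      omega
  · have map_sel_zero (U : Finset (Fin p)) (hU : (U.card : ℤ) ≠ b) :
        (θ fun i => c.sel U i (v i)) = 0 :=
      h _ U (fun i hi => c.sel_mem_sections hi _) (fun i hi => c.sel_mem_horizontal hi _)
        fun hc => hU (le_antisymm hc.2 hc.1)
    rw [c.eq_sum_sel θ]
    refine ⟨fun hS hb => Finset.sum_eq_zero fun U _ => ?_,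
      fun hS ha => Finset.sum_eq_zero fun U _ => ?_⟩
    · by_cases hSU : S ⊆ U
      · have := Finset.card_le_card hSU
        exact map_sel_zero U (by omega)
      · obtain ⟨i, hi, hiU⟩ := Finset.not_subset.1 hSU
        exact θ.map_coord_zero i (by rw [c.sel_of_mem_sections (hS i hi), if_neg hiU])
    · by_cases hSU : Disjoint S U
      · have := (Finset.card_union_of_disjoint hSU).symm.trans_le (card_finset_fin_le _)
        exact map_sel_zero U (by omega)
      · obtain ⟨i, hi, hiU⟩ := Finset.not_disjoint_iff.1 hSU
        exact θ.map_coord_zero i (by rw [c.sel_of_mem_horizontal (hS i hi), if_pos hiU])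

theorem isOfType_dComponent (hθ : c.IsOfType a b θ) (j : ℤ) :
    c.IsOfType (a + (1 - j)) (b + j) (c.dComponent j p θ) := by
  obtain ⟨hab, hθ⟩ := isOfType_iff.1 hθ
  rw [isOfType_iff, dComponent_of_mem hθ]
  exact ⟨by push_cast; omega, typePart_mem _ _⟩

theorem apply_proj_of_mem_annForms (hθ : θ ∈ c.annForms p) (v : Fin p → VF n M) :
    (θ fun i => c.proj (v i)) = θ v := by
  rw [c.eq_sum_sel θ v, Finset.sum_eq_single_of_mem Finset.univ (Finset.mem_univ _)]
  · simp [sel]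
  · intro S _ hS
    obtain ⟨i, hi⟩ : ∃ i, i ∉ S := by simpa [Finset.eq_univ_iff_forall] using hS
    exact hθ _ ⟨i, c.sel_mem_horizontal hi (v i)⟩

variable (c)

/-- The isomorphism `Γ(Λ^p T^*F) → Γ(Λ^p H⁰)`, `(h α)(X₁, …) = α(γ X₁, …)`; its inverse is the
restriction of forms to the leaves. -/
def pullbackEquiv (p : ℕ) : Form n M F.sections p ≃ₗ[Fun n M] c.annForms p where
  toFun α := ⟨α.compLinearMap c.projF, fun _ ⟨i, hi⟩ => α.map_coord_zero i (Subtype.ext hi)⟩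
  map_add' _ _ := rfl
  map_smul' _ _ := rfl
  invFun θ := (θ : Form n M (VF n M) p).compLinearMap F.sections.subtype
  left_inv α := by
    ext v : 1
    exact congrArg α (funext fun i => Subtype.ext (c.proj_of_mem (v i).2))
  right_inv θ := by
    ext v : 2
    exact apply_proj_of_mem_annForms θ.2 v

theorem pullbackEquiv_apply (p : ℕ) (α : Form n M F.sections p) (v : Fin p → VF n M) :
    (c.pullbackEquiv p α : Form n M (VF n M) p) v = α fun i => c.projF (v i) := rfl

theorem pullbackEquiv_foliatedD (p : ℕ) (α : Form n M F.sections p) :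
    (c.pullbackEquiv (p + 1) (F.foliatedD p α) : Form n M (VF n M) (p + 1)) =
      c.d01 p (c.pullbackEquiv p α : Form n M (VF n M) p) := by
  rw [← differential_eq_d01]
  exact (koszul_compLinearMap _ c.bracket _ _ _ F.algebroid.bracket _ _ c.projF (fun _ => rfl)
    (fun X Y => Subtype.ext (c.proj_bracket X Y)) α).symm

variable {c}

theorem d01_mem_annForms (hθ : θ ∈ c.annForms p) : c.d01 p θ ∈ c.annForms (p + 1) := by
  obtain ⟨α, hα⟩ := (c.pullbackEquiv p).surjective ⟨θ, hθ⟩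
  obtain rfl : (c.pullbackEquiv p α : Form n M (VF n M) p) = θ := congrArg Subtype.val hα
  rw [← pullbackEquiv_foliatedD]
  exact Subtype.property _

variable (c)

theorem restrict_algebroid_sections :
    c.algebroid.restrict F.sections (fun _ hX _ hY => bracket_mem_sections hX hY) =
      F.algebroid := by
  ext X : 2
  · exact c.proj_of_mem X.2
  · ext Y : 1
    exact Subtype.ext (bracket_of_mem_sections X.2 Y.2)

end EhresmannConnection

end FoliatedAlgebroid

end

theorem mainTheorem10_general {n : ℕ} {M : Type*} [TopologicalSpace M]
    [ChartedSpace (EuclideanSpace ℝ (Fin n)) M] [IsManifold (𝓡 n) ∞ M]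
    (F : RegularFoliation n M) (c : EhresmannConnection F) :
    (tangentAlgebroid n M).IsAssociatedOperator (extD n M) ∧
    c.algebroid.IsAssociatedOperator c.algebroid.differential ∧
    F.algebroid.IsAssociatedOperator F.foliatedD ∧
    (∀ (p : ℕ) (θ : Form n M (VF n M) p),
      c.algebroid.differential (p + 1) (c.algebroid.differential p θ) = 0) ∧
    (∀ (p : ℕ) (α : Form n M F.sections p), F.foliatedD (p + 1) (F.foliatedD p α) = 0) ∧
    (∀ p : ℕ, extD n M p = c.d10 p + c.d2m1 p + c.d01 p) ∧
    (∀ (p : ℕ) (a b : ℤ) (θ : Form n M (VF n M) p), c.IsOfType a b θ →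
      c.IsOfType (a + 1) b (c.d10 p θ) ∧ c.IsOfType a (b + 1) (c.d01 p θ) ∧
        c.IsOfType (a + 2) (b - 1) (c.d2m1 p θ)) ∧
    (∀ p : ℕ, c.algebroid.differential p = c.d01 p) ∧
    (∃ hF : ∀ X ∈ F.sections, ∀ Y ∈ F.sections, c.algebroid.bracket X Y ∈ F.sections,
      c.algebroid.restrict F.sections hF = F.algebroid) ∧
    (∀ p : ℕ, ∀ θ ∈ c.annForms p, c.d01 p θ ∈ c.annForms (p + 1)) ∧
    ∃ h : ∀ p : ℕ, Form n M F.sections p ≃ₗ[Fun n M] c.annForms p,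
      (∀ (p : ℕ) (α : Form n M F.sections p) (v : Fin p → VF n M),
        (h p α : Form n M (VF n M) p) v = α fun i => c.projF (v i)) ∧
      ∀ (p : ℕ) (α : Form n M F.sections p),
        (h (p + 1) (F.foliatedD p α) : Form n M (VF n M) (p + 1)) =
          c.d01 p (h p α : Form n M (VF n M) p) := by
  refine ⟨LieAlgebroid.isAssociatedOperator_differential _,
    LieAlgebroid.isAssociatedOperator_differential _,
    LieAlgebroid.isAssociatedOperator_differential _,
    c.algebroid.differential_differential c.proj_bracket,
    F.algebroid.differential_differential fun _ _ => rfl,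
    c.extD_eq_add, fun p a b θ hθ => ⟨?_, ?_, ?_⟩, c.differential_eq_d01,
    ⟨_, c.restrict_algebroid_sections⟩, fun _ _ hθ => EhresmannConnection.d01_mem_annForms hθ,
    c.pullbackEquiv, c.pullbackEquiv_apply, c.pullbackEquiv_foliatedD⟩
  · simpa using EhresmannConnection.isOfType_dComponent hθ 0
  · simpa using EhresmannConnection.isOfType_dComponent hθ 1
  · simpa [sub_eq_add_neg] using EhresmannConnection.isOfType_dComponent hθ (-1)

theorem mainTheorem10 {n : ℕ} {M : Type*} [TopologicalSpace M] [T2Space M]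
    [SecondCountableTopology M] [ChartedSpace (EuclideanSpace ℝ (Fin n)) M]
    [IsManifold (𝓡 n) ∞ M] (F : RegularFoliation n M) (c : EhresmannConnection F) :
    -- the Koszul differentials of the three Lie algebroids `(TM, Id, [·, ·])`,
    -- `(TM, γ, [·, ·]_γ + T_γ)`, `(TF, j, [·, ·]_F)` are the associated operators
    (tangentAlgebroid n M).IsAssociatedOperator (extD n M) ∧
    c.algebroid.IsAssociatedOperator c.algebroid.differential ∧
    F.algebroid.IsAssociatedOperator F.foliatedD ∧
    -- the last two of them are cohomology operators
    (∀ (p : ℕ) (θ : Form n M (VF n M) p),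
      c.algebroid.differential (p + 1) (c.algebroid.differential p θ) = 0) ∧
    (∀ (p : ℕ) (α : Form n M F.sections p), F.foliatedD (p + 1) (F.foliatedD p α) = 0) ∧
    -- `d_{1,0}`, `d_{0,1}`, `d_{2,-1}` are the components of `d`
    (∀ p : ℕ, extD n M p = c.d10 p + c.d2m1 p + c.d01 p) ∧
    (∀ (p : ℕ) (a b : ℤ) (θ : Form n M (VF n M) p), c.IsOfType a b θ →
      c.IsOfType (a + 1) b (c.d10 p θ) ∧ c.IsOfType a (b + 1) (c.d01 p θ) ∧
        c.IsOfType (a + 2) (b - 1) (c.d2m1 p θ)) ∧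
    -- `D = d_{0,1}`
    (∀ p : ℕ, c.algebroid.differential p = c.d01 p) ∧
    -- the restriction to `TF` of the Lie algebroid on `TM` is the Lie algebroid of the foliation
    (∃ hF : ∀ X ∈ F.sections, ∀ Y ∈ F.sections, c.algebroid.bracket X Y ∈ F.sections,
      c.algebroid.restrict F.sections hF = F.algebroid) ∧
    -- `d_{0,1}` restricts to `Γ(ΛH⁰)`, and the resulting complex is isomorphic to the foliated one
    (∀ p : ℕ, ∀ θ ∈ c.annForms p, c.d01 p θ ∈ c.annForms (p + 1)) ∧
    ∃ h : ∀ p : ℕ, Form n M F.sections p ≃ₗ[Fun n M] c.annForms p,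
      (∀ (p : ℕ) (α : Form n M F.sections p) (v : Fin p → VF n M),
        (h p α : Form n M (VF n M) p) v = α fun i => c.projF (v i)) ∧
      ∀ (p : ℕ) (α : Form n M F.sections p),
        (h (p + 1) (F.foliatedD p α) : Form n M (VF n M) (p + 1)) =
          c.d01 p (h p α : Form n M (VF n M) p) := by
  exact mainTheorem10_general F c
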